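/- Let $c\neq 0$ be a real number and let $(P,J,G)$ be a non-flat complex space form of complex dimension $2$, that is, a Kähler manifold of complex dimension $2$ with Riemannian metric $G$, parallel complex structure $J$ and constant holomorphic sectional curvature $c$ (the complete simply connected ones are $\mathbb{C}P^2$ for $c>0$ and $\mathbb{C}H^2$ for $c<0$). Let $f\colon M\to P$ be a smooth immersed real hypersurface (so $\dim_{\mathbb R} M=3$) without boundary, with the induced metric $g=f^*G$, its Riemannian curvature tensor $R(X,Y)Z=\nabla_X\nabla_YZ-\nabla_Y\nabla_XZ-\nabla_{[X,Y]}Z$, and a smooth unit normal vector field $N$ along $f$. Let $\xi=-JN$ be its structure vector field, $\eta(X)=g(X,\xi)$, and let $A$ be the shape operator with respect to $N$, $\overline\nabla_XN=-AX$, where $\overline\nabla$ is the Levi-Civita connection of $G$. Suppose that there is a smooth function $\kappa\colon M\to\mathbb R$ such that $$R(X,Y)\xi=\kappa\,[\eta(Y)X-\eta(X)Y]$$ for all tangent vectors $X,Y$ of $M$ at any point. Then $M$ is Hopf: at every point, $\xi$ is an eigenvector of $A$, that is, $A\xi=\alpha\xi$ for some $\alpha\in\mathbb R$. -/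

import Mathlib

open Bundle Manifold
open scoped ContDiff

noncomputable section

/-! ## Riemannian geometry: Levi-Civita connection and curvature

`TangentSpace I : M → Type` is the tangent bundle. A Riemannian metric is Mathlib's
`RiemannianBundle (TangentSpace I)`, so that `inner ℝ u v` and `‖u‖` refer to that metric for
tangent vectors `u v`. For a connection `∇`, the vector `cov Y x u` is `∇_u Y` at the point `x`. -/

section Riemannian

variable {E : Type*} [NormedAddCommGroup E] [NormedSpace ℝ E] [FiniteDimensional ℝ E]
  {H : Type*} [TopologicalSpace H] {I : ModelWithCorners ℝ E H}
  {M : Type*} [TopologicalSpace M] [ChartedSpace H M] [IsManifold I ∞ M]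

/-- `∇` is the Levi-Civita (Riemannian) connection: it is compatible with the metric,
`u ⟨Y, Z⟩ = ⟨∇_u Y, Z⟩ + ⟨Y, ∇_u Z⟩`, and torsion free, `∇_X Y - ∇_Y X = [X, Y]`. -/
structure IsLeviCivita [RiemannianBundle (fun x : M ↦ TangentSpace I x)]
    (cov : CovariantDerivative I E (TangentSpace I : M → Type _)) : Prop where
  metric : ∀ (Y Z : Π x : M, TangentSpace I x) (x : M),
    MDifferentiableAt I I.tangent (fun y ↦ (⟨y, Y y⟩ : TangentBundle I M)) x →
    MDifferentiableAt I I.tangent (fun y ↦ (⟨y, Z y⟩ : TangentBundle I M)) x →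
    ∀ u : TangentSpace I x,
      mvfderiv I (fun y ↦ (inner ℝ (Y y) (Z y) : ℝ)) x u
        = inner ℝ (cov Y x u) (Z x) + inner ℝ (Y x) (cov Z x u)
  torsionFree : ∀ (X Y : Π x : M, TangentSpace I x) (x : M),
    MDifferentiableAt I I.tangent (fun y ↦ (⟨y, X y⟩ : TangentBundle I M)) x →
    MDifferentiableAt I I.tangent (fun y ↦ (⟨y, Y y⟩ : TangentBundle I M)) x →
    cov Y x (X x) - cov X x (Y x) = VectorField.mlieBracket I X Y x

/-- For vector fields `X, Y, Z`, the vector field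
`R(X, Y) Z = ∇_X ∇_Y Z - ∇_Y ∇_X Z - ∇_{[X, Y]} Z`. -/
def curvatureField (cov : CovariantDerivative I E (TangentSpace I : M → Type _))
    (X Y Z : Π x : M, TangentSpace I x) (x : M) : TangentSpace I x :=
  cov (fun y ↦ cov Z y (Y y)) x (X x) - cov (fun y ↦ cov Z y (X y)) x (Y x)
    - cov Z x (VectorField.mlieBracket I X Y x)

/-- The curvature tensor `R(u, v) w` at the point `x`, for tangent vectors `u, v, w` at `x`.
It is computed with vector fields that are smooth near `x` and take the values `u, v, w` at `x`
(`FiberBundle.extend` extends a vector with constant coefficients in the chart at `x`). -/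
def curvatureTensor (cov : CovariantDerivative I E (TangentSpace I : M → Type _))
    (x : M) (u v w : TangentSpace I x) : TangentSpace I x :=
  curvatureField cov (FiberBundle.extend E u) (FiberBundle.extend E v) (FiberBundle.extend E w) x

/-- `J` is a Kähler structure for the given Riemannian metric with Levi-Civita connection `cov`:
a smooth field of endomorphisms of the tangent spaces with `J² = -1`, preserving the metric, and
parallel, that is, `∇_u (J Y) = J (∇_u Y)`. -/
structure IsKaehlerStructure [RiemannianBundle (fun x : M ↦ TangentSpace I x)]
    (cov : CovariantDerivative I E (TangentSpace I : M → Type _))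
    (J : Π x : M, TangentSpace I x →L[ℝ] TangentSpace I x) : Prop where
  smooth : ContMDiff I (I.prod 𝓘(ℝ, E →L[ℝ] E)) ∞
    (fun x ↦ TotalSpace.mk' (E →L[ℝ] E)
      (E := fun x : M ↦ TangentSpace I x →L[ℝ] TangentSpace I x) x (J x))
  sq : ∀ (x : M) (u : TangentSpace I x), J x (J x u) = -u
  isometric : ∀ (x : M) (u v : TangentSpace I x), inner ℝ (J x u) (J x v) = inner ℝ u v
  parallel : ∀ (Y : Π x : M, TangentSpace I x) (x : M),
    MDifferentiableAt I I.tangent (fun y ↦ (⟨y, Y y⟩ : TangentBundle I M)) x →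
      ∀ u : TangentSpace I x, cov (fun y ↦ J y (Y y)) x u = J x (cov Y x u)

/-- Constant holomorphic sectional curvature `c`: every plane spanned by a non-zero tangent vector
`u` and `J u` has sectional curvature `c`, that is, `⟨R(u, Ju)Ju, u⟩ = c ‖u‖⁴`. -/
def HasConstantHolomorphicSectionalCurvature [RiemannianBundle (fun x : M ↦ TangentSpace I x)]
    (cov : CovariantDerivative I E (TangentSpace I : M → Type _))
    (J : Π x : M, TangentSpace I x →L[ℝ] TangentSpace I x) (c : ℝ) : Prop :=
  ∀ (x : M) (u : TangentSpace I x),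
    inner ℝ (curvatureTensor cov x u (J x u) (J x u)) u = c * ‖u‖ ^ 4

end Riemannian

/-! ## Hypersurfaces -/

section Hypersurface

variable {E : Type*} [NormedAddCommGroup E] [NormedSpace ℝ E] [FiniteDimensional ℝ E]
  {H : Type*} [TopologicalSpace H] {I : ModelWithCorners ℝ E H}
  {M : Type*} [TopologicalSpace M] [ChartedSpace H M] [IsManifold I ∞ M]
  {E' : Type*} [NormedAddCommGroup E'] [NormedSpace ℝ E'] [FiniteDimensional ℝ E']
  {H' : Type*} [TopologicalSpace H'] {I' : ModelWithCorners ℝ E' H'}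
  {P : Type*} [TopologicalSpace P] [ChartedSpace H' P] [IsManifold I' ∞ P]

/-- The covariant derivative `∇̄_u V` at the point `p` of a vector field `V` along a map
`f : M → P` in the direction `u`, for a connection `∇̄` on `P` (pull-back connection). If `V^i` are
the coefficients of `V` in the frame `(e_i)` of `TP` given by the chart at `f p`, this is
`∑ i, V^i(p) ∇̄_{df u} e_i + ∑ i, dV^i(u) e_i`; the first sum is the derivative of the vector field
on `P` with constant coefficients `V^i(p)`. -/
def covariantDerivativeAlong (cov : CovariantDerivative I' E' (TangentSpace I' : P → Type _))
    (f : M → P) (V : Π q : M, TangentSpace I' (f q)) (p : M) (u : TangentSpace I p) :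
    TangentSpace I' (f p) :=
  cov (FiberBundle.extend E' (V p)) (f p) (mfderiv I I' f p u)
    + (trivializationAt E' (TangentSpace I' : P → Type _) (f p)).symmL ℝ (f p)
        (mvfderiv I
          (fun q ↦ (trivializationAt E' (TangentSpace I' : P → Type _) (f p)
            (⟨f q, V q⟩ : TangentBundle I' P)).2) p u)

variable [RiemannianBundle (fun q : M ↦ TangentSpace I q)]
  [RiemannianBundle (fun x : P ↦ TangentSpace I' x)]

/-- `f : M → P` is a (smooth) isometric immersion and `N` is a smooth unit normal vector field
along `f`. In particular the metric of `M` is the one induced by `f`. -/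
structure IsImmersedWithUnitNormal (f : M → P) (N : Π q : M, TangentSpace I' (f q)) : Prop where
  immersion : IsImmersion I I' ∞ f
  isometric : ∀ (p : M) (u v : TangentSpace I p),
    inner ℝ (mfderiv I I' f p u) (mfderiv I I' f p v) = inner ℝ u v
  smooth : ContMDiff I I'.tangent ∞ (fun q ↦ (⟨f q, N q⟩ : TangentBundle I' P))
  normal : ∀ (p : M) (u : TangentSpace I p), inner ℝ (N p) (mfderiv I I' f p u) = 0
  unit : ∀ p : M, ‖N p‖ = 1

/-- The tangential component of a vector `w` of the ambient space at `f p`, as a tangent vector of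
`M` at `p`: it is characterized by `g(wᵀ, u) = G(w, df u)` for all `u`. For an isometric immersion
`f`, `df` maps `wᵀ` to the orthogonal projection of `w` to the image of `df`. -/
def tangentialComponent (f : M → P) (p : M) (w : TangentSpace I' (f p)) : TangentSpace I p :=
  haveI : FiniteDimensional ℝ (TangentSpace I p) := inferInstanceAs (FiniteDimensional ℝ E)
  haveI : FiniteDimensional ℝ (TangentSpace I' (f p)) := inferInstanceAs (FiniteDimensional ℝ E')
  LinearMap.adjoint (mfderiv I I' f p : TangentSpace I p →ₗ[ℝ] TangentSpace I' (f p)) w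

/-- The structure vector field `ξ = -J N` of the hypersurface. -/
def structureVectorField (J : Π x : P, TangentSpace I' x →L[ℝ] TangentSpace I' x)
    (f : M → P) (N : Π q : M, TangentSpace I' (f q)) (p : M) : TangentSpace I p :=
  tangentialComponent f p (-(J (f p) (N p)))

/-- The shape operator `A` with respect to `N`: `∇̄_u N = -A u`. -/
def shapeOperator (cov : CovariantDerivative I' E' (TangentSpace I' : P → Type _))
    (f : M → P) (N : Π q : M, TangentSpace I' (f q)) (p : M) (u : TangentSpace I p) :
    TangentSpace I p :=
  -tangentialComponent f p (covariantDerivativeAlong cov f N p u)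

/-- The hypersurface is Hopf: at every point the structure vector is a principal vector, that is,
an eigenvector (`A ξ = α ξ` with `ξ ≠ 0`) of the shape operator. -/
def IsHopf (cov : CovariantDerivative I' E' (TangentSpace I' : P → Type _))
    (J : Π x : P, TangentSpace I' x →L[ℝ] TangentSpace I' x)
    (f : M → P) (N : Π q : M, TangentSpace I' (f q)) : Prop :=
  ∀ p : M, (structureVectorField J f N p : TangentSpace I p) ≠ 0 ∧ ∃ α : ℝ,
    shapeOperator cov f N p (structureVectorField J f N p : TangentSpace I p)
      = α • structureVectorField J f N p

end Hypersurface

end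

/-! Suppose `ξ` is not principal at `p` and write `Aξ = v + αξ` with `v ≠ 0` orthogonal to `ξ`.
Since `Jξ = N` is normal, the `J`-terms of the ambient curvature drop out of the Gauss equation for
`R(X, Y)ξ`. With `θ(X) = ⟨AX, ξ⟩`, the nullity condition becomes `(κ - c/4)(η(Y)X - η(X)Y) = θ(Y)AX
- θ(X)AY` (`gauss_of_nullity`). The vector `V = Jv` is tangent, orthogonal to `ξ` and `v`, and
satisfies `θ(V) = 0`. The pair `(V, v)` gives `AV = 0`, then `(V, ξ)` gives `κ = c/4` at `p`. What
remains, `θ(Y)AX = θ(X)AY`, says that `A` has rank one; moreover `α ≠ 0`, `⟨Av, v⟩ ≠ 0`, and `V` and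
`W = |v|²ξ - αv` lie in the kernel of `A` (`rank_one_of_nullity`).

Being non-principal is an open condition (`eventually_not_principal`), so the `2 × 2` minors of the
second fundamental form `h` vanish near `p` and may be differentiated there. The minor with rows `X,
v` and columns `W, v`, for `X = V` or `X = W`, yields `h(v, v) dh(X, W) = 0`, hence `dh(X, W) = 0`.
The Codazzi equation in the directions `V, W`, paired with `W`, then has a vanishing derivative
side, while its curvature side is a nonzero multiple of `c α |v|⁴`. This is a contradiction
(`exists_principal`).

The remaining work supplies the Gauss equation, the Codazzi equation in kernel directions (the only
case needed), and the curvature tensor of a complex space form, recovered from its holomorphic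
sectional curvature by polarization. The differential identities are proved for Christoffel symbols
on open sets of vector spaces and then carried to the manifolds through charts. -/

noncomputable section

set_option maxSynthPendingDepth 3
set_option linter.unusedSectionVars false

/-! ### Tangent vectors, fields and derivatives in a chart -/

section Coordinates

open Topology

variable {E : Type*} [NormedAddCommGroup E] [NormedSpace ℝ E]
  {M : Type*} [TopologicalSpace M] [ChartedSpace E M] [IsManifold 𝓘(ℝ, E) ∞ M]

/-- The coordinate vector at `x` with constant coefficients `u` in the chart at `x₀`. -/
def coordVec (x₀ x : M) : E →L[ℝ] TangentSpace 𝓘(ℝ, E) x :=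
  (trivializationAt E (TangentSpace 𝓘(ℝ, E) : M → Type _) x₀).symmL ℝ x

/-- The coefficients of a tangent vector at `x` in the chart at `x₀`. -/
def vecCoord (x₀ x : M) : TangentSpace 𝓘(ℝ, E) x →L[ℝ] E :=
  (trivializationAt E (TangentSpace 𝓘(ℝ, E) : M → Type _) x₀).continuousLinearMapAt ℝ x

/-- A function on `M`, read in the chart at `x₀`. -/
def inChart {F : Type*} (x₀ : M) (h : M → F) : E → F := fun y ↦ h ((chartAt E x₀).symm y)

theorem mem_baseSet_of_mem_source {x₀ x : M} (hx : x ∈ (chartAt E x₀).source) :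
    x ∈ (trivializationAt E (TangentSpace 𝓘(ℝ, E) : M → Type _) x₀).baseSet := by
  simpa using hx

theorem vecCoord_coordVec {x₀ x : M} (hx : x ∈ (chartAt E x₀).source) (u : E) :
    vecCoord x₀ x (coordVec x₀ x u) = u :=
  Trivialization.continuousLinearMapAt_symmL _ (mem_baseSet_of_mem_source hx) u

theorem coordVec_vecCoord {x₀ x : M} (hx : x ∈ (chartAt E x₀).source)
    (u : TangentSpace 𝓘(ℝ, E) x) :
    coordVec x₀ x (vecCoord x₀ x u) = u :=
  Trivialization.symmL_continuousLinearMapAt _ (mem_baseSet_of_mem_source hx) u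

theorem vecCoord_apply {x₀ x : M} (hx : x ∈ (chartAt E x₀).source) (u : TangentSpace 𝓘(ℝ, E) x) :
    vecCoord x₀ x u
      = (trivializationAt E (TangentSpace 𝓘(ℝ, E) : M → Type _) x₀
          (⟨x, u⟩ : TangentBundle 𝓘(ℝ, E) M)).2 := by
  rw [vecCoord, Trivialization.continuousLinearMapAt_apply,
    Trivialization.linearMapAt_apply, if_pos (mem_baseSet_of_mem_source hx)]

theorem extend_eq_coordVec {x₀ x : M} (hx : x ∈ (chartAt E x₀).source)
    (v : TangentSpace 𝓘(ℝ, E) x₀) :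
    FiberBundle.extend E v x = coordVec x₀ x (vecCoord x₀ x₀ v) := by
  rw [vecCoord_apply (mem_chart_source E x₀), coordVec, FiberBundle.extend,
    Trivialization.symmL_apply _ (mem_baseSet_of_mem_source hx)]

theorem mdifferentiableAt_vectorField_iff {x₀ x : M} (hx : x ∈ (chartAt E x₀).source)
    (Y : Π x : M, TangentSpace 𝓘(ℝ, E) x) :
    MDifferentiableAt 𝓘(ℝ, E) 𝓘(ℝ, E).tangent
      (fun y ↦ (⟨y, Y y⟩ : TangentBundle 𝓘(ℝ, E) M)) x ↔
    MDifferentiableAt 𝓘(ℝ, E) 𝓘(ℝ, E) (fun y ↦ vecCoord x₀ y (Y y)) x := by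
  rw [ModelWithCorners.tangent,
    Trivialization.mdifferentiableAt_section_iff 𝓘(ℝ, E)
      (trivializationAt E (TangentSpace 𝓘(ℝ, E) : M → Type _) x₀) Y
      (mem_baseSet_of_mem_source hx)]
  apply Filter.EventuallyEq.mdifferentiableAt_iff
  filter_upwards [(chartAt E x₀).open_source.mem_nhds hx] with y hy
  rw [vecCoord_apply hy]

theorem contMDiffAt_vectorField_iff {n : ℕ∞} {x₀ x : M} (hx : x ∈ (chartAt E x₀).source)
    (Y : Π x : M, TangentSpace 𝓘(ℝ, E) x) :
    ContMDiffAt 𝓘(ℝ, E) 𝓘(ℝ, E).tangent n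
      (fun y ↦ (⟨y, Y y⟩ : TangentBundle 𝓘(ℝ, E) M)) x ↔
    ContMDiffAt 𝓘(ℝ, E) 𝓘(ℝ, E) n (fun y ↦ vecCoord x₀ y (Y y)) x := by
  have : IsManifold 𝓘(ℝ, E) (n + 1) M := .of_le (n := ∞) (by exact_mod_cast le_top)
  have : ContMDiffVectorBundle n E (TangentSpace 𝓘(ℝ, E) : M → Type _) 𝓘(ℝ, E) :=
    inferInstance
  rw [ModelWithCorners.tangent,
    Trivialization.contMDiffAt_section_iff
      (trivializationAt E (TangentSpace 𝓘(ℝ, E) : M → Type _) x₀)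
      (mem_baseSet_of_mem_source hx)]
  apply Filter.EventuallyEq.contMDiffAt_iff
  filter_upwards [(chartAt E x₀).open_source.mem_nhds hx] with y hy
  rw [vecCoord_apply hy]

theorem contMDiffAt_coordVec {n : ℕ∞} {x₀ x : M} (hx : x ∈ (chartAt E x₀).source) (u : E) :
    ContMDiffAt 𝓘(ℝ, E) 𝓘(ℝ, E).tangent n
      (fun y ↦ (⟨y, coordVec x₀ y u⟩ : TangentBundle 𝓘(ℝ, E) M)) x := by
  rw [contMDiffAt_vectorField_iff hx]
  refine contMDiffAt_const (c := u) |>.congr_of_eventuallyEq ?_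
  filter_upwards [(chartAt E x₀).open_source.mem_nhds hx] with y hy
  rw [vecCoord_coordVec hy]

theorem mdifferentiableAt_coordVec {x₀ x : M} (hx : x ∈ (chartAt E x₀).source) (u : E) :
    MDifferentiableAt 𝓘(ℝ, E) 𝓘(ℝ, E).tangent
      (fun y ↦ (⟨y, coordVec x₀ y u⟩ : TangentBundle 𝓘(ℝ, E) M)) x :=
  (contMDiffAt_coordVec (n := 1) hx u).mdifferentiableAt (by simp)

section

variable {F : Type*} [NormedAddCommGroup F] [NormedSpace ℝ F]

omit [NormedSpace ℝ E] [IsManifold 𝓘(ℝ, E) ∞ M] in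
theorem inChart_chartAt {x₀ x : M} (hx : x ∈ (chartAt E x₀).source) {G : Type*} (h : M → G) :
    inChart x₀ h (chartAt E x₀ x) = h x := by
  rw [inChart, (chartAt E x₀).left_inv hx]

theorem contMDiffAt_iff_inChart {n : ℕ∞} {x₀ x : M} (hx : x ∈ (chartAt E x₀).source) (h : M → F) :
    ContMDiffAt 𝓘(ℝ, E) 𝓘(ℝ, F) n h x ↔ ContDiffAt ℝ n (inChart x₀ h) (chartAt E x₀ x) := by
  have : IsManifold 𝓘(ℝ, E) n M := .of_le (n := ∞) (by exact_mod_cast le_top)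
  rw [contMDiffAt_iff_source_of_mem_source hx, ← contMDiffAt_iff_contDiffAt]
  simp only [mfld_simps, contMDiffWithinAt_univ, Function.comp_def]
  rfl

theorem mdifferentiableAt_iff_inChart {x₀ x : M} (hx : x ∈ (chartAt E x₀).source) (h : M → F) :
    MDifferentiableAt 𝓘(ℝ, E) 𝓘(ℝ, F) h x ↔
      DifferentiableAt ℝ (inChart x₀ h) (chartAt E x₀ x) := by
  have : IsManifold 𝓘(ℝ, E) 1 M := .of_le (n := ∞) (by exact_mod_cast le_top)
  rw [← mdifferentiableWithinAt_univ, mdifferentiableWithinAt_iff_source_of_mem_source hx,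
    ← mdifferentiableAt_iff_differentiableAt]
  simp only [mfld_simps, mdifferentiableWithinAt_univ, Function.comp_def]
  rfl

/-- The tangent bundle is trivialized by the derivatives of its charts; this lets the chain rule for
the chart act on coefficients. -/
theorem vecCoord_eq_mfderiv {x₀ x : M} (hx : x ∈ (chartAt E x₀).source)
    (u : TangentSpace 𝓘(ℝ, E) x) :
    vecCoord x₀ x u = mfderiv 𝓘(ℝ, E) 𝓘(ℝ, E) (chartAt E x₀) x u := by
  have : IsManifold 𝓘(ℝ, E) 1 M := .of_le (n := ∞) (by exact_mod_cast le_top)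
  rw [vecCoord, TangentBundle.continuousLinearMapAt_trivializationAt hx]
  simp only [mfld_simps]
  rfl

theorem mvfderiv_eq_fderiv_inChart {x₀ x : M} (hx : x ∈ (chartAt E x₀).source) {h : M → F}
    (hh : MDifferentiableAt 𝓘(ℝ, E) 𝓘(ℝ, F) h x) (u : TangentSpace 𝓘(ℝ, E) x) :
    mvfderiv 𝓘(ℝ, E) h x u = fderiv ℝ (inChart x₀ h) (chartAt E x₀ x) (vecCoord x₀ x u) := by
  have : IsManifold 𝓘(ℝ, E) 1 M := .of_le (n := ∞) (by exact_mod_cast le_top)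
  have hd := (mdifferentiableAt_iff_inChart hx h).1 hh
  have hφ : MDifferentiableAt 𝓘(ℝ, E) 𝓘(ℝ, E) (chartAt E x₀) x := by
    have := mdifferentiableAt_extChartAt (I := 𝓘(ℝ, E)) hx
    simpa using this
  have e : h =ᶠ[𝓝 x] inChart x₀ h ∘ chartAt E x₀ := by
    filter_upwards [(chartAt E x₀).open_source.mem_nhds hx] with y hy
    rw [Function.comp_apply, inChart_chartAt hy]
  have h2 : mfderiv 𝓘(ℝ, E) 𝓘(ℝ, F) h x u
      = mfderiv 𝓘(ℝ, E) 𝓘(ℝ, F) (inChart x₀ h ∘ chartAt E x₀) x u := by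
    rw [e.mfderiv_eq]; rfl
  have h3 := mfderiv_comp x hd.mdifferentiableAt hφ
  rw [vecCoord_eq_mfderiv hx, ← mfderiv_eq_fderiv]
  change mfderiv 𝓘(ℝ, E) 𝓘(ℝ, F) h x u = _
  rw [h2, h3]
  rfl

end

end Coordinates

/-! ### Christoffel symbols and commuting coordinate fields -/

section Connection

open Topology

variable {E : Type*} [NormedAddCommGroup E] [NormedSpace ℝ E] [FiniteDimensional ℝ E]
  {M : Type*} [TopologicalSpace M] [ChartedSpace E M] [IsManifold 𝓘(ℝ, E) ∞ M]
  (cov : CovariantDerivative 𝓘(ℝ, E) E (TangentSpace 𝓘(ℝ, E) : M → Type _))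

omit [FiniteDimensional ℝ E] in
theorem vecCoord_cov_add {x₀ x : M} {Y Z : Π x : M, TangentSpace 𝓘(ℝ, E) x}
    (hY : MDifferentiableAt 𝓘(ℝ, E) 𝓘(ℝ, E).tangent
      (fun y ↦ (⟨y, Y y⟩ : TangentBundle 𝓘(ℝ, E) M)) x)
    (hZ : MDifferentiableAt 𝓘(ℝ, E) 𝓘(ℝ, E).tangent
      (fun y ↦ (⟨y, Z y⟩ : TangentBundle 𝓘(ℝ, E) M)) x) (u : TangentSpace 𝓘(ℝ, E) x) :
    vecCoord x₀ x (cov (Y + Z) x u) = vecCoord x₀ x (cov Y x u) + vecCoord x₀ x (cov Z x u) := by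
  rw [cov.isCovariantDerivativeOnUniv.add hY hZ, _root_.add_apply, map_add]

/-- The Christoffel symbols at `x`, in the chart at `x₀`, as a bilinear map. -/
def christoffel (x₀ x : M) : E →L[ℝ] E →L[ℝ] E :=
  open Classical in
  if hx : x ∈ (chartAt E x₀).source then
    (LinearMap.mk₂ ℝ (fun u v ↦ vecCoord x₀ x (cov (fun y ↦ coordVec x₀ y v) x (coordVec x₀ x u)))
      (by simp) (by simp)
      (fun u v w ↦ by
        rw [← vecCoord_cov_add cov (mdifferentiableAt_coordVec hx v)
          (mdifferentiableAt_coordVec hx w)]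
        congr 3; ext y; simp)
      (fun c u v ↦ by
        have := cov.isCovariantDerivativeOnUniv.smul_const c (mdifferentiableAt_coordVec hx v)
        rw [← map_smul, ← _root_.smul_apply, ← this]
        congr 3; ext y; simp)).toContinuousBilinearMap
  -- Outside the chart domain the coordinate frame has no meaning; this default is never evaluated
  -- in the geometric identities.
  else 0

theorem christoffel_apply {x₀ x : M} (hx : x ∈ (chartAt E x₀).source) (u v : E) :
    christoffel cov x₀ x u v
      = vecCoord x₀ x (cov (fun y ↦ coordVec x₀ y v) x (coordVec x₀ x u)) := by
  rw [christoffel, dif_pos hx]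
  simp

omit [FiniteDimensional ℝ E] in
theorem differentiableAt_inChart_vecCoord {x₀ x : M} (hx : x ∈ (chartAt E x₀).source)
    {Y : Π x : M, TangentSpace 𝓘(ℝ, E) x}
    (hY : MDifferentiableAt 𝓘(ℝ, E) 𝓘(ℝ, E).tangent
      (fun y ↦ (⟨y, Y y⟩ : TangentBundle 𝓘(ℝ, E) M)) x) :
    DifferentiableAt ℝ (inChart x₀ fun y ↦ vecCoord x₀ y (Y y)) (chartAt E x₀ x) :=
  (mdifferentiableAt_iff_inChart hx _).1 ((mdifferentiableAt_vectorField_iff hx Y).1 hY)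

omit [NormedSpace ℝ E] [FiniteDimensional ℝ E] [IsManifold 𝓘(ℝ, E) ∞ M] in
/-- Two functions which agree near a point agree near the point in a chart. -/
theorem inChart_eventuallyEq {F : Type*} {x₀ x : M} (hx : x ∈ (chartAt E x₀).source)
    {h k : M → F} (hk : h =ᶠ[𝓝 x] k) :
    inChart x₀ h =ᶠ[𝓝 (chartAt E x₀ x)] inChart x₀ k := by
  have hc : Filter.Tendsto (chartAt E x₀).symm (𝓝 (chartAt E x₀ x)) (𝓝 x) := by
    have := (chartAt E x₀).symm.continuousAt ((chartAt E x₀).map_source hx)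
    rwa [ContinuousAt, (chartAt E x₀).left_inv hx] at this
  exact hc.eventually hk

/-- The covariant derivative in coordinates. -/
theorem vecCoord_cov {x₀ x : M} (hx : x ∈ (chartAt E x₀).source)
    {Y : Π x : M, TangentSpace 𝓘(ℝ, E) x}
    (hY : MDifferentiableAt 𝓘(ℝ, E) 𝓘(ℝ, E).tangent
      (fun y ↦ (⟨y, Y y⟩ : TangentBundle 𝓘(ℝ, E) M)) x) (u : E) :
    vecCoord x₀ x (cov Y x (coordVec x₀ x u))
      = fderiv ℝ (inChart x₀ fun y ↦ vecCoord x₀ y (Y y)) (chartAt E x₀ x) u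
        + christoffel cov x₀ x u (vecCoord x₀ x (Y x)) := by
  have : IsManifold 𝓘(ℝ, E) (1 + 1) M :=
    .of_le (n := ∞) (by rw [one_add_one_eq_two]; exact ENat.LEInfty.out)
  have : ContMDiffVectorBundle 1 E (TangentSpace 𝓘(ℝ, E) : M → Type _) 𝓘(ℝ, E) :=
    inferInstance
  -- The Leibniz terms of `∇_u Y` and of the ordinary derivative of the coefficients cancel, so the
  -- difference depends only on `Y x`. It can thus be evaluated on the field with constant
  -- coefficients, where the ordinary derivative vanishes and `∇` is the Christoffel symbol.
  have key : TensorialAt 𝓘(ℝ, E) E (fun Y : Π x : M, TangentSpace 𝓘(ℝ, E) x ↦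
      vecCoord x₀ x (cov Y x (coordVec x₀ x u))
        - fderiv ℝ (inChart x₀ fun y ↦ vecCoord x₀ y (Y y)) (chartAt E x₀ x) u) x := by
    constructor
    · intro f Z hf hZ
      have h1 : (inChart x₀ fun y ↦ vecCoord x₀ y ((f • Z) y))
          = fun y : E ↦ (inChart x₀ f) y • (inChart x₀ fun y ↦ vecCoord x₀ y (Z y)) y := by
        ext y; simp [inChart]
      have hf' := (mdifferentiableAt_iff_inChart hx _).1 hf
      rw [h1, fderiv_fun_smul hf' (differentiableAt_inChart_vecCoord hx hZ) (x := chartAt E x₀ x),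
        cov.isCovariantDerivativeOnUniv.leibniz hZ hf, inChart_chartAt hx, inChart_chartAt hx]
      simp only [_root_.add_apply, _root_.smul_apply, map_add, map_smul,
        ContinuousLinearMap.smulRight_apply, smul_sub]
      rw [mvfderiv_eq_fderiv_inChart hx hf, vecCoord_coordVec hx]
      abel
    · intro Z W hZ hW
      have h1 : (inChart x₀ fun y ↦ vecCoord x₀ y ((Z + W) y))
          = ((inChart x₀ fun y ↦ vecCoord x₀ y (Z y)) : E → E)
            + (inChart x₀ fun y ↦ vecCoord x₀ y (W y)) := by
        ext y; simp [inChart]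
      rw [h1, fderiv_add (differentiableAt_inChart_vecCoord hx hZ)
        (differentiableAt_inChart_vecCoord hx hW), vecCoord_cov_add cov hZ hW]
      simp only [_root_.add_apply]
      abel
  have h := key.pointwise hY (mdifferentiableAt_coordVec hx (vecCoord x₀ x (Y x)))
    (coordVec_vecCoord hx _).symm
  have h2 : fderiv ℝ (inChart x₀ fun y ↦ vecCoord x₀ y (coordVec x₀ y (vecCoord x₀ x (Y x))))
      (chartAt E x₀ x) = 0 := by
    have : (fun y ↦ vecCoord x₀ y (coordVec x₀ y (vecCoord x₀ x (Y x))))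
        =ᶠ[𝓝 x] fun _ ↦ vecCoord x₀ x (Y x) := by
      filter_upwards [(chartAt E x₀).open_source.mem_nhds hx] with y hy
      rw [vecCoord_coordVec hy]
    rw [(inChart_eventuallyEq hx this).fderiv_eq]
    exact fderiv_const_apply _
  simp only [h2] at h
  rw [← christoffel_apply cov hx, _root_.zero_apply, sub_zero] at h
  rw [← h]
  abel

/-- Coordinate vector fields commute. -/
theorem mlieBracket_coordVec {x₀ x : M} (hx : x ∈ (chartAt E x₀).source) (u v : E) :
    VectorField.mlieBracket 𝓘(ℝ, E) (fun y ↦ coordVec x₀ y u) (fun y ↦ coordVec x₀ y v) x = 0 := by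
  have : IsManifold 𝓘(ℝ, E) 1 M := .of_le (n := ∞) ENat.LEInfty.out
  have : IsManifold 𝓘(ℝ, E) 2 M := .of_le (n := ∞) ENat.LEInfty.out
  have : IsManifold 𝓘(ℝ, E) (minSmoothness ℝ 2) M := by simpa using this
  have : IsManifold 𝓘(ℝ, E) (minSmoothness ℝ 2) E := by
    simpa using (inferInstance : IsManifold 𝓘(ℝ, E) 2 E)
  -- A coordinate field is the pullback by the chart of a constant field; pullback commutes with
  -- brackets, and constant fields commute.
  have hpull (w : E) : (fun y ↦ coordVec x₀ y w) =ᶠ[𝓝 x]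
      VectorField.mpullback 𝓘(ℝ, E) 𝓘(ℝ, E) (chartAt E x₀)
        (fun _ ↦ w : Π y : E, TangentSpace 𝓘(ℝ, E) y) := by
    filter_upwards [(chartAt E x₀).open_source.mem_nhds hx] with y hy
    have hi : (mfderiv 𝓘(ℝ, E) 𝓘(ℝ, E) (chartAt E x₀) y).IsInvertible := by
      have := isInvertible_mfderiv_extChartAt (I := 𝓘(ℝ, E)) (x := x₀) (y := y) (by simpa using hy)
      simp only [mfld_simps] at this
      exact this
    have e := vecCoord_eq_mfderiv hy (coordVec x₀ y w)
    rw [vecCoord_coordVec hy] at e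
    exact (hi.inverse_apply_eq.2 e).symm
  rw [(hpull u).mlieBracket_vectorField_eq (hpull v)]
  have hφ : ContMDiffAt 𝓘(ℝ, E) 𝓘(ℝ, E) 2 (chartAt E x₀) x := by
    have := contMDiffAt_extChartAt' (I := 𝓘(ℝ, E)) (n := 2) hx
    simpa only [mfld_simps] using this
  have hc (w : E) : MDifferentiableAt 𝓘(ℝ, E) 𝓘(ℝ, E).tangent
      (fun y ↦ (⟨y, w⟩ : TangentBundle 𝓘(ℝ, E) E)) (chartAt E x₀ x) :=
    (contMDiffAt_vectorSpace_iff_contDiffAt (V := fun _ : E ↦ w) (n := 1).2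
      contDiffAt_const).mdifferentiableAt (by simp)
  rw [← VectorField.mpullback_mlieBracket (n := 2) (hc u) (hc v) hφ (by simp)]
  have h0 (V W : Π y : E, TangentSpace 𝓘(ℝ, E) y) (y : E) :
      VectorField.mlieBracket 𝓘(ℝ, E) V W y = VectorField.lieBracket ℝ V W y := by
    rw [← VectorField.mlieBracketWithin_univ, VectorField.mlieBracketWithin_eq_lieBracketWithin]
    exact congrFun VectorField.lieBracketWithin_univ y
  have h1 : VectorField.lieBracket ℝ (fun _ : E ↦ u) (fun _ ↦ v) (chartAt E x₀ x) = 0 := by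
    simp [VectorField.lieBracket]
  exact (congrArg _ ((h0 _ _ _).trans h1)).trans (map_zero _)

end Connection

/-! ### Metric connections on open sets and the Koszul formula -/

section MetricConnection

open Topology

variable {E : Type*} [NormedAddCommGroup E] [NormedSpace ℝ E]

/-- `Γ` is the family of Christoffel symbols of the Levi-Civita connection of the metric `g` on the
open set `U`, and everything is smooth. -/
structure IsMetricConnectionOn (g : E → E →L[ℝ] E →L[ℝ] ℝ) (Γ : E → E →L[ℝ] E →L[ℝ] E)
    (U : Set E) : Prop where
  isOpen : IsOpen U
  contDiffOn_metric : ContDiffOn ℝ ∞ g U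
  contDiffOn_connection : ContDiffOn ℝ ∞ Γ U
  metric_symm : ∀ y ∈ U, ∀ u v, g y u v = g y v u
  connection_symm : ∀ y ∈ U, ∀ u v, Γ y u v = Γ y v u
  compatible : ∀ y ∈ U, ∀ u v w, fderiv ℝ g y w u v = g y (Γ y w u) v + g y u (Γ y w v)

/-- The curvature of the connection with Christoffel symbols `Γ`. -/
def coordCurvature (Γ : E → E →L[ℝ] E →L[ℝ] E) (y u v w : E) : E :=
  fderiv ℝ Γ y u v w - fderiv ℝ Γ y v u w + Γ y u (Γ y v w) - Γ y v (Γ y u w)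

variable [FiniteDimensional ℝ E]

/-- A positive definite bilinear form, as an isomorphism to the dual space. -/
def posDefEquiv (b : E →L[ℝ] E →L[ℝ] ℝ) (hb : ∀ u, u ≠ 0 → 0 < b u u) : E ≃L[ℝ] (E →L[ℝ] ℝ) :=
  (LinearEquiv.ofInjectiveOfFinrankEq (b : E →ₗ[ℝ] E →L[ℝ] ℝ)
    ((injective_iff_map_eq_zero _).2 fun u hu ↦ by
      by_contra h
      have := hb u h
      rw [show b u = 0 from hu] at this
      exact lt_irrefl _ this)
    (by
      rw [← (LinearMap.toContinuousLinearMap : (E →ₗ[ℝ] ℝ) ≃ₗ[ℝ] E →L[ℝ] ℝ).finrank_eq]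
      exact (Subspace.dual_finrank_eq).symm)).toContinuousLinearEquiv

theorem coe_posDefEquiv (b : E →L[ℝ] E →L[ℝ] ℝ) (hb : ∀ u, u ≠ 0 → 0 < b u u) :
    (posDefEquiv b hb : E →L[ℝ] E →L[ℝ] ℝ) = b := by
  ext u v
  rfl

/-- The Christoffel symbols of a smooth metric are smooth, by the Koszul formula. -/
theorem contDiffOn_connection_of_metric {g : E → E →L[ℝ] E →L[ℝ] ℝ} {Γ : E → E →L[ℝ] E →L[ℝ] E}
    {U : Set E} (hU : IsOpen U) (hg : ContDiffOn ℝ ∞ g U)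
    (hpos : ∀ y ∈ U, ∀ u, u ≠ 0 → 0 < g y u u)
    (hgs : ∀ y ∈ U, ∀ u v, g y u v = g y v u) (hΓ : ∀ y ∈ U, ∀ u v, Γ y u v = Γ y v u)
    (hc : ∀ y ∈ U, ∀ u v w, fderiv ℝ g y w u v = g y (Γ y w u) v + g y u (Γ y w v)) :
    ContDiffOn ℝ ∞ Γ U := by
  have hdg : ContDiffOn ℝ ∞ (fderiv ℝ g) U :=
    hg.fderiv_of_isOpen hU (by simp)
  refine contDiffOn_clm_apply.2 fun u ↦ contDiffOn_clm_apply.2 fun v ↦ ?_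
  -- The Koszul covector: half of `∂_u g(v, w) + ∂_v g(u, w) - ∂_w g(u, v)`, as a function of `w`.
  -- It involves only derivatives of `g`.
  let K : E → E →L[ℝ] ℝ := fun y ↦
    (1 / 2 : ℝ) • (fderiv ℝ g y u v + fderiv ℝ g y v u - ((fderiv ℝ g y).flip u).flip v)
  have hK : ContDiffOn ℝ ∞ K U := by
    refine contDiffOn_clm_apply.2 fun w ↦ ?_
    have h (a b c : E) : ContDiffOn ℝ ∞ (fun y ↦ fderiv ℝ g y a b c) U :=
      ((hdg.clm_apply contDiffOn_const).clm_apply contDiffOn_const).clm_apply contDiffOn_const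
    exact (((h u v w).add (h v u w)).sub (h w u v)).const_smul (1 / 2 : ℝ)
  -- Positive definiteness makes `g y` invertible as a map to the dual, and inversion of continuous
  -- linear maps is smooth at invertible ones.
  have hinv : ContDiffOn ℝ ∞ (fun y ↦ (g y).inverse) U := fun y hy ↦ by
    have := contDiffAt_map_inverse (n := ∞) (𝕜 := ℝ) (posDefEquiv (g y) (hpos y hy))
    rw [coe_posDefEquiv] at this
    exact this.comp_contDiffWithinAt y (hg y hy)
  refine (hinv.clm_apply hK).congr fun y hy ↦ ?_
  have h1 : g y (Γ y u v) = K y := by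
    ext w
    simp only [K, _root_.smul_apply, _root_.add_apply, _root_.sub_apply,
      ContinuousLinearMap.flip_apply, smul_eq_mul]
    rw [hc y hy, hc y hy, hc y hy, hgs y hy (Γ y w u), hΓ y hy v u, hΓ y hy w u, hΓ y hy w v,
      hgs y hy v (Γ y u w)]
    ring
  rw [← h1, ← coe_posDefEquiv (g y) (hpos y hy), ContinuousLinearMap.inverse_equiv]
  simp

end MetricConnection

/-! ### The Levi-Civita connection in a chart -/

section LeviCivita

open Topology

variable {E : Type*} [NormedAddCommGroup E] [NormedSpace ℝ E] [FiniteDimensional ℝ E]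
  {M : Type*} [TopologicalSpace M] [ChartedSpace E M] [IsManifold 𝓘(ℝ, E) ∞ M]
  [RiemannianBundle (fun x : M ↦ TangentSpace 𝓘(ℝ, E) x)]

/-- The coefficients at `x` of the metric in the chart at `x₀`. -/
def metricCoeff (x₀ x : M) : E →L[ℝ] E →L[ℝ] ℝ :=
  (innerSL ℝ : TangentSpace 𝓘(ℝ, E) x →L[ℝ] TangentSpace 𝓘(ℝ, E) x →L[ℝ] ℝ).bilinearComp
    (coordVec x₀ x) (coordVec x₀ x)

omit [FiniteDimensional ℝ E] in
theorem metricCoeff_apply (x₀ x : M) (u v : E) :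
    metricCoeff x₀ x u v = inner ℝ (coordVec x₀ x u) (coordVec x₀ x v) := rfl

omit [FiniteDimensional ℝ E] in
theorem metricCoeff_vecCoord {x₀ x : M} (hx : x ∈ (chartAt E x₀).source)
    (u v : TangentSpace 𝓘(ℝ, E) x) :
    metricCoeff x₀ x (vecCoord x₀ x u) (vecCoord x₀ x v) = inner ℝ u v := by
  rw [metricCoeff_apply, coordVec_vecCoord hx, coordVec_vecCoord hx]

variable [IsContMDiffRiemannianBundle 𝓘(ℝ, E) ∞ E (fun x : M ↦ TangentSpace 𝓘(ℝ, E) x)]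

omit [FiniteDimensional ℝ E] in
theorem contMDiffAt_metricCoeff_apply {x₀ x : M} (hx : x ∈ (chartAt E x₀).source) (u v : E) :
    ContMDiffAt 𝓘(ℝ, E) 𝓘(ℝ, ℝ) ∞ (fun y ↦ metricCoeff x₀ y u v) x := by
  have h := ContMDiffAt.inner_bundle (IB := 𝓘(ℝ, E)) (F := E) (n := ∞) (b := fun y : M ↦ y)
    (E := fun x : M ↦ TangentSpace 𝓘(ℝ, E) x)
    (contMDiffAt_coordVec (n := ⊤) hx u) (contMDiffAt_coordVec (n := ⊤) hx v)
  exact h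

theorem contDiffOn_inChart_metricCoeff (x₀ : M) :
    ContDiffOn ℝ ∞ (inChart x₀ (metricCoeff (E := E) x₀)) (chartAt E x₀).target := by
  refine contDiffOn_clm_apply.2 fun u ↦ contDiffOn_clm_apply.2 fun v ↦ fun y hy ↦ ?_
  have hx := (chartAt E x₀).map_target hy
  have := (contMDiffAt_iff_inChart (n := ⊤) hx _).1 (contMDiffAt_metricCoeff_apply hx u v)
  rw [(chartAt E x₀).right_inv hy] at this
  exact this.contDiffWithinAt

omit [FiniteDimensional ℝ E]
  [IsContMDiffRiemannianBundle 𝓘(ℝ, E) ∞ E (fun x : M ↦ TangentSpace 𝓘(ℝ, E) x)] in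
theorem metricCoeff_pos {x₀ x : M} (hx : x ∈ (chartAt E x₀).source) (u : E) (hu : u ≠ 0) :
    0 < metricCoeff x₀ x u u := by
  rw [metricCoeff_apply]
  refine real_inner_self_pos.2 fun h ↦ hu ?_
  rw [← vecCoord_coordVec hx u, h, map_zero]

variable (cov : CovariantDerivative 𝓘(ℝ, E) E (TangentSpace 𝓘(ℝ, E) : M → Type _))

omit [RiemannianBundle (fun x : M ↦ TangentSpace 𝓘(ℝ, E) x)]
  [IsContMDiffRiemannianBundle 𝓘(ℝ, E) ∞ E (fun x : M ↦ TangentSpace 𝓘(ℝ, E) x)] in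
theorem coordVec_christoffel {x₀ x : M} (hx : x ∈ (chartAt E x₀).source) (u v : E) :
    coordVec x₀ x (christoffel cov x₀ x u v)
      = cov (fun y ↦ coordVec x₀ y v) x (coordVec x₀ x u) := by
  rw [christoffel_apply cov hx, coordVec_vecCoord hx]

variable {cov}

/-- Evaluate the two axioms on coordinate fields: these commute, so vanishing torsion is symmetry of
the Christoffel symbols, and metric compatibility is the formula for the derivative of the metric
coefficients. A `CovariantDerivative` carries no smoothness here; it comes from the smooth metric
through Koszul's formula. -/
theorem IsLeviCivita.isMetricConnectionOn (hcov : IsLeviCivita cov) (x₀ : M) :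
    IsMetricConnectionOn (inChart x₀ (metricCoeff (E := E) x₀)) (inChart x₀ (christoffel cov x₀))
      (chartAt E x₀).target := by
  have hU := (chartAt E x₀).open_target
  have hg := contDiffOn_inChart_metricCoeff (E := E) x₀
  have hgs : ∀ y ∈ (chartAt E x₀).target, ∀ u v,
      inChart x₀ (metricCoeff (E := E) x₀) y u v = inChart x₀ (metricCoeff (E := E) x₀) y v u :=
    fun y _ u v ↦ by
      simpa only [inChart, metricCoeff_apply] using real_inner_comm _ _
  have hΓ : ∀ y ∈ (chartAt E x₀).target, ∀ u v,
      inChart x₀ (christoffel cov x₀) y u v = inChart x₀ (christoffel cov x₀) y v u := by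
    intro y hy u v
    have hx := (chartAt E x₀).map_target hy
    have h := hcov.torsionFree _ _ _ (mdifferentiableAt_coordVec hx u)
      (mdifferentiableAt_coordVec hx v)
    rw [mlieBracket_coordVec hx, sub_eq_zero] at h
    rw [inChart, christoffel_apply cov hx, christoffel_apply cov hx, h]
  have hc : ∀ y ∈ (chartAt E x₀).target, ∀ u v w,
      fderiv ℝ (inChart x₀ (metricCoeff (E := E) x₀)) y w u v
        = inChart x₀ (metricCoeff (E := E) x₀) y (inChart x₀ (christoffel cov x₀) y w u) v
          + inChart x₀ (metricCoeff (E := E) x₀) y u (inChart x₀ (christoffel cov x₀) y w v) := by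
    intro y hy u v w
    have hx := (chartAt E x₀).map_target hy
    have h := hcov.metric _ _ _ (mdifferentiableAt_coordVec hx u)
      (mdifferentiableAt_coordVec hx v) (coordVec x₀ _ w)
    have hd := (contMDiffAt_metricCoeff_apply hx u v).mdifferentiableAt (by simp)
    have h2 := mvfderiv_eq_fderiv_inChart hx hd (coordVec x₀ _ w)
    rw [(chartAt E x₀).right_inv hy, vecCoord_coordVec hx] at h2
    have h3 : fderiv ℝ (inChart x₀ fun z ↦ metricCoeff x₀ z u v) y w
        = fderiv ℝ (inChart x₀ (metricCoeff (E := E) x₀)) y w u v := by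
      have hdg := ((hg.contDiffAt (hU.mem_nhds hy)).differentiableAt (by simp)).hasFDerivAt
      have := (hdg.clm_apply (hasFDerivAt_const u y)).clm_apply (hasFDerivAt_const v y)
      have e : (inChart x₀ fun z ↦ metricCoeff x₀ z u v)
          = fun z : E ↦ inChart x₀ (metricCoeff (E := E) x₀) z u v := rfl
      rw [e, this.fderiv]
      simp
    rw [← h3, ← h2]
    refine h.trans ?_
    rw [← coordVec_christoffel cov hx, ← coordVec_christoffel cov hx]
    rfl
  refine ⟨hU, hg, ?_, hgs, hΓ, hc⟩
  exact contDiffOn_connection_of_metric hU hg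
    (fun y hy ↦ metricCoeff_pos ((chartAt E x₀).map_target hy)) hgs hΓ hc

end LeviCivita

/-! ### The curvature tensor in a chart -/

section Curvature

open Topology

variable {E : Type*} [NormedAddCommGroup E] [NormedSpace ℝ E] [FiniteDimensional ℝ E]
  {M : Type*} [TopologicalSpace M] [ChartedSpace E M] [IsManifold 𝓘(ℝ, E) ∞ M]
  (cov : CovariantDerivative 𝓘(ℝ, E) E (TangentSpace 𝓘(ℝ, E) : M → Type _))

omit [FiniteDimensional ℝ E] in
theorem extend_eventuallyEq {x₀ x : M} (hx : x ∈ (chartAt E x₀).source) (u : E) :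
    ∀ᶠ y in 𝓝 x, FiberBundle.extend E (coordVec x₀ x₀ u) y = coordVec x₀ y u := by
  filter_upwards [(chartAt E x₀).open_source.mem_nhds hx] with y hy
  rw [extend_eq_coordVec hy, vecCoord_coordVec (mem_chart_source E x₀)]

omit [FiniteDimensional ℝ E] in
theorem mdifferentiableAt_extend_of_mem {x₀ x : M} (hx : x ∈ (chartAt E x₀).source) (u : E) :
    MDifferentiableAt 𝓘(ℝ, E) 𝓘(ℝ, E).tangent
      (fun y ↦ (⟨y, FiberBundle.extend E (coordVec x₀ x₀ u) y⟩ : TangentBundle 𝓘(ℝ, E) M)) x := by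
  refine (mdifferentiableAt_coordVec hx u).congr_of_eventuallyEq ?_
  filter_upwards [extend_eventuallyEq hx u] with y hy
  rw [hy]

theorem vecCoord_cov_extend {x₀ x : M} (hx : x ∈ (chartAt E x₀).source) (v w : E) :
    vecCoord x₀ x (cov (FiberBundle.extend E (coordVec x₀ x₀ w)) x
      (FiberBundle.extend E (coordVec x₀ x₀ v) x)) = christoffel cov x₀ x v w := by
  rw [cov.isCovariantDerivativeOnUniv.congr_of_eventuallyEq
    (mdifferentiableAt_extend_of_mem hx w) (mdifferentiableAt_coordVec hx w) Filter.univ_mem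
    (extend_eventuallyEq hx w), (extend_eventuallyEq hx v).self_of_nhds, christoffel_apply cov hx]

/-- The curvature tensor in coordinates. -/
theorem vecCoord_curvatureTensor {x₀ : M}
    (hΓ : DifferentiableAt ℝ (inChart x₀ (christoffel cov x₀)) (chartAt E x₀ x₀)) (u v w : E) :
    vecCoord x₀ x₀
      (curvatureTensor cov x₀ (coordVec x₀ x₀ u) (coordVec x₀ x₀ v) (coordVec x₀ x₀ w))
      = coordCurvature (inChart x₀ (christoffel cov x₀)) (chartAt E x₀ x₀) u v w := by
  have hx := mem_chart_source E x₀
  -- Near `x₀` the field `∇_b w` has coefficients `Γ(b, w)`, so a second covariant derivative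
  -- produces a derivative of `Γ` and a product of two `Γ`. The bracket term of the curvature is
  -- zero because the extensions are coordinate fields.
  have key (a b : E) : vecCoord x₀ x₀ (cov (fun y ↦ cov (FiberBundle.extend E (coordVec x₀ x₀ w)) y
        (FiberBundle.extend E (coordVec x₀ x₀ b) y)) x₀ (coordVec x₀ x₀ a))
      = fderiv ℝ (inChart x₀ (christoffel cov x₀)) (chartAt E x₀ x₀) a b w
        + christoffel cov x₀ x₀ a (christoffel cov x₀ x₀ b w) := by
    have he : (fun y ↦ vecCoord x₀ y (cov (FiberBundle.extend E (coordVec x₀ x₀ w)) y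
        (FiberBundle.extend E (coordVec x₀ x₀ b) y))) =ᶠ[𝓝 x₀]
        fun y ↦ christoffel cov x₀ y b w := by
      filter_upwards [(chartAt E x₀).open_source.mem_nhds hx] with y hy
      exact vecCoord_cov_extend cov hy b w
    have hi := inChart_eventuallyEq hx he
    have hd := (hΓ.hasFDerivAt.clm_apply (hasFDerivAt_const b _)).clm_apply
      (hasFDerivAt_const w (chartAt E x₀ x₀))
    have hm : MDifferentiableAt 𝓘(ℝ, E) 𝓘(ℝ, E).tangent
        (fun y ↦ (⟨y, cov (FiberBundle.extend E (coordVec x₀ x₀ w)) y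
        (FiberBundle.extend E (coordVec x₀ x₀ b) y)⟩ : TangentBundle 𝓘(ℝ, E) M)) x₀ := by
      rw [mdifferentiableAt_vectorField_iff hx, mdifferentiableAt_iff_inChart hx]
      exact hd.differentiableAt.congr_of_eventuallyEq hi
    rw [vecCoord_cov cov hx hm, vecCoord_cov_extend cov hx, hi.fderiv_eq]
    have e : (inChart x₀ fun y ↦ christoffel cov x₀ y b w)
      = fun z : E ↦ inChart x₀ (christoffel cov x₀) z b w := rfl
    rw [e, hd.fderiv]
    simp
  have hb : VectorField.mlieBracket 𝓘(ℝ, E) (FiberBundle.extend E (coordVec x₀ x₀ u))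
      (FiberBundle.extend E (coordVec x₀ x₀ v)) x₀ = 0 := by
    rw [Filter.EventuallyEq.mlieBracket_vectorField_eq (extend_eventuallyEq hx u)
      (extend_eventuallyEq hx v), mlieBracket_coordVec hx]
  rw [curvatureTensor, curvatureField, hb, map_zero, sub_zero, map_sub,
    (extend_eventuallyEq hx u).self_of_nhds, (extend_eventuallyEq hx v).self_of_nhds,
    key, key, coordCurvature, inChart_chartAt hx]
  abel

end Curvature

/-! ### Vector fields along a map, in a pair of charts -/

section Along

open Topology

variable {E : Type*} [NormedAddCommGroup E] [NormedSpace ℝ E]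
  {M : Type*} [TopologicalSpace M] [ChartedSpace E M] [IsManifold 𝓘(ℝ, E) ∞ M]
  {E' : Type*} [NormedAddCommGroup E'] [NormedSpace ℝ E']
  {P : Type*} [TopologicalSpace P] [ChartedSpace E' P] [IsManifold 𝓘(ℝ, E') ∞ P]

/-- A map between manifolds in the charts at `p` and `f p`. -/
def mapInCharts (f : M → P) (p : M) : E → E' := inChart p fun q ↦ chartAt E' (f p) (f q)

/-- A vector field along a map, in the charts at `p` and `f p`. -/
def alongInCharts (f : M → P) (V : Π q : M, TangentSpace 𝓘(ℝ, E') (f q)) (p : M) : E → E' :=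
  inChart p fun q ↦ vecCoord (f p) (f q) (V q)

theorem mdifferentiableAt_chartAt {x₀ x : P}
    (hx : x ∈ (chartAt E' x₀).source) :
    MDifferentiableAt 𝓘(ℝ, E') 𝓘(ℝ, E') (chartAt E' x₀) x := by
  have : IsManifold 𝓘(ℝ, E') 1 P := .of_le (n := ∞) ENat.LEInfty.out
  have := mdifferentiableAt_extChartAt (I := 𝓘(ℝ, E')) hx
  simpa using this

theorem vecCoord_mfderiv {f : M → P} {p q : M} (hq : q ∈ (chartAt E p).source)
    (hfq : f q ∈ (chartAt E' (f p)).source) (hf : MDifferentiableAt 𝓘(ℝ, E) 𝓘(ℝ, E') f q)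
    (u : TangentSpace 𝓘(ℝ, E) q) :
    vecCoord (f p) (f q) (mfderiv 𝓘(ℝ, E) 𝓘(ℝ, E') f q u)
      = fderiv ℝ (mapInCharts f p) (chartAt E p q) (vecCoord p q u) := by
  have hφ := mdifferentiableAt_chartAt hfq
  have h := mvfderiv_eq_fderiv_inChart hq (hφ.comp q hf) u
  rw [vecCoord_eq_mfderiv hfq]
  exact (mfderiv_comp_apply q hφ hf u).symm.trans h

omit [IsManifold 𝓘(ℝ, E) ∞ M] in
theorem mdifferentiableAt_along_iff {f : M → P} {V : Π q : M, TangentSpace 𝓘(ℝ, E') (f q)}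
    {y : P} {q : M} (hfq : f q ∈ (chartAt E' y).source) :
    MDifferentiableAt 𝓘(ℝ, E) 𝓘(ℝ, E').tangent
      (fun q ↦ (⟨f q, V q⟩ : TangentBundle 𝓘(ℝ, E') P)) q ↔
    MDifferentiableAt 𝓘(ℝ, E) 𝓘(ℝ, E') f q ∧
      MDifferentiableAt 𝓘(ℝ, E) 𝓘(ℝ, E') (fun q ↦ vecCoord y (f q) (V q)) q := by
  rw [ModelWithCorners.tangent, Trivialization.mdifferentiableAt_totalSpace_iff 𝓘(ℝ, E')
    (trivializationAt E' (TangentSpace 𝓘(ℝ, E') : P → Type _) y) _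
    (by simpa [Trivialization.mem_source] using hfq)]
  refine and_congr_right fun hf ↦ Filter.EventuallyEq.mdifferentiableAt_iff ?_
  filter_upwards [hf.continuousAt.preimage_mem_nhds
    ((chartAt E' y).open_source.mem_nhds hfq)] with z hz
  rw [vecCoord_apply hz]

omit [IsManifold 𝓘(ℝ, E) ∞ M] in
theorem contMDiffAt_along_iff {f : M → P} {V : Π q : M, TangentSpace 𝓘(ℝ, E') (f q)}
    {y : P} {q : M} (hfq : f q ∈ (chartAt E' y).source) :
    ContMDiffAt 𝓘(ℝ, E) 𝓘(ℝ, E').tangent ∞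
      (fun q ↦ (⟨f q, V q⟩ : TangentBundle 𝓘(ℝ, E') P)) q ↔
    ContMDiffAt 𝓘(ℝ, E) 𝓘(ℝ, E') ∞ f q ∧
      ContMDiffAt 𝓘(ℝ, E) 𝓘(ℝ, E') ∞ (fun q ↦ vecCoord y (f q) (V q)) q := by
  have : IsManifold 𝓘(ℝ, E') (∞ + 1) P := inferInstanceAs (IsManifold 𝓘(ℝ, E') ∞ P)
  have : ContMDiffVectorBundle ∞ E' (TangentSpace 𝓘(ℝ, E') : P → Type _) 𝓘(ℝ, E') :=
    inferInstance
  rw [ModelWithCorners.tangent, Trivialization.contMDiffAt_iff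
    (e := trivializationAt E' (TangentSpace 𝓘(ℝ, E') : P → Type _) y)
    (by simpa [Trivialization.mem_source] using hfq)]
  refine and_congr_right fun hf ↦ Filter.EventuallyEq.contMDiffAt_iff ?_
  filter_upwards [hf.continuousAt.preimage_mem_nhds
    ((chartAt E' y).open_source.mem_nhds hfq)] with z hz
  rw [vecCoord_apply hz]

/-- The derivative along `f` at `q` is defined with the frame of the chart at `f q`, whereas
computations near `p` use one fixed chart at `f p`. The change of frame between them has to be
differentiated. -/
theorem mdifferentiableAt_coordChange {y y' x : P} (hx : x ∈ (chartAt E' y).source)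
    (hx' : x ∈ (chartAt E' y').source) :
    MDifferentiableAt 𝓘(ℝ, E') 𝓘(ℝ, E' →L[ℝ] E')
      (fun z : P ↦ (vecCoord (E := E') y' z).comp (coordVec (E := E') y z)) x := by
  have : IsManifold 𝓘(ℝ, E') (1 + 1) P :=
    .of_le (n := ∞) (by rw [one_add_one_eq_two]; exact ENat.LEInfty.out)
  have : ContMDiffVectorBundle 1 E' (TangentSpace 𝓘(ℝ, E') : P → Type _) 𝓘(ℝ, E') :=
    inferInstance
  have h := contMDiffAt_coordChangeL (n := 1) (IB := 𝓘(ℝ, E'))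
    (e := trivializationAt E' (TangentSpace 𝓘(ℝ, E') : P → Type _) y)
    (e' := trivializationAt E' (TangentSpace 𝓘(ℝ, E') : P → Type _) y')
    (mem_baseSet_of_mem_source hx) (mem_baseSet_of_mem_source hx')
  refine (h.mdifferentiableAt (by simp)).congr_of_eventuallyEq ?_
  filter_upwards [(chartAt E' y).open_source.mem_nhds hx,
    (chartAt E' y').open_source.mem_nhds hx'] with z hz hz'
  ext w
  rw [ContinuousLinearMap.comp_apply, vecCoord_apply hz', coordVec,
    Trivialization.symmL_apply _ (mem_baseSet_of_mem_source hz)]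
  exact (Trivialization.coordChangeL_apply _ _
    ⟨mem_baseSet_of_mem_source hz, mem_baseSet_of_mem_source hz'⟩ w).symm

variable [FiniteDimensional ℝ E']

/-- The covariant derivative along a map, in coordinates. -/
theorem vecCoord_covariantDerivativeAlong
    (cov : CovariantDerivative 𝓘(ℝ, E') E' (TangentSpace 𝓘(ℝ, E') : P → Type _))
    {f : M → P} {V : Π q : M, TangentSpace 𝓘(ℝ, E') (f q)} {p q : M}
    (hq : q ∈ (chartAt E p).source) (hfq : f q ∈ (chartAt E' (f p)).source)
    (hV : MDifferentiableAt 𝓘(ℝ, E) 𝓘(ℝ, E').tangent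
      (fun q ↦ (⟨f q, V q⟩ : TangentBundle 𝓘(ℝ, E') P)) q)
    (u : TangentSpace 𝓘(ℝ, E) q) :
    vecCoord (f p) (f q) (covariantDerivativeAlong cov f V q u)
      = fderiv ℝ (alongInCharts f V p) (chartAt E p q) (vecCoord p q u)
        + christoffel cov (f p) (f q)
            (fderiv ℝ (mapInCharts f p) (chartAt E p q) (vecCoord p q u))
            (vecCoord (f p) (f q) (V q)) := by
  have hself := mem_chart_source E' (f q)
  obtain ⟨hf, hW⟩ := (mdifferentiableAt_along_iff hself).1 hV
  set W : M → E' := fun z ↦ vecCoord (f q) (f z) (V z) with hWdef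
  set T : P → E' →L[ℝ] E' := fun z ↦ (vecCoord (f p) z).comp (coordVec (f q) z) with hT
  have hTd := mdifferentiableAt_coordChange hself hfq
  have hnear : ∀ᶠ z in 𝓝 q, f z ∈ (chartAt E' (f q)).source :=
    hf.continuousAt.preimage_mem_nhds ((chartAt E' (f q)).open_source.mem_nhds hself)
  -- the field with constant coefficients in the chart at `f q`
  have hY : MDifferentiableAt 𝓘(ℝ, E') 𝓘(ℝ, E').tangent
      (fun y ↦ (⟨y, FiberBundle.extend E' (V q) y⟩ : TangentBundle 𝓘(ℝ, E') P)) (f q) := by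
    have := mdifferentiableAt_extend_of_mem hself (vecCoord (f q) (f q) (V q))
    rwa [coordVec_vecCoord hself] at this
  have h1 := vecCoord_cov cov hfq hY (vecCoord (f p) (f q) (mfderiv 𝓘(ℝ, E) 𝓘(ℝ, E') f q u))
  rw [coordVec_vecCoord hfq, FiberBundle.extend_apply_self] at h1
  have e1 : (fun z ↦ vecCoord (f p) z (FiberBundle.extend E' (V q) z))
      =ᶠ[𝓝 (f q)] fun z ↦ T z (W q) := by
    filter_upwards [(chartAt E' (f q)).open_source.mem_nhds hself] with z hz
    rw [extend_eq_coordVec hz]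
    rfl
  have hTW : MDifferentiableAt 𝓘(ℝ, E') 𝓘(ℝ, E') (fun z ↦ T z (W q)) (f q) :=
    hTd.clm_apply mdifferentiableAt_const
  have hcomp : mvfderiv 𝓘(ℝ, E) ((fun z ↦ T z (W q)) ∘ f) q u
      = mvfderiv 𝓘(ℝ, E') (fun z ↦ T z (W q)) (f q) (mfderiv 𝓘(ℝ, E) 𝓘(ℝ, E') f q u) :=
    mfderiv_comp_apply q hTW hf u
  rw [(inChart_eventuallyEq hfq e1).fderiv_eq, ← mvfderiv_eq_fderiv_inChart hfq hTW,
    ← hcomp, mvfderiv_eq_fderiv_inChart hq (hTW.comp q hf)] at h1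
  -- the derivative of the coefficients
  have h2 : vecCoord (f p) (f q) ((trivializationAt E' (TangentSpace 𝓘(ℝ, E') : P → Type _)
      (f q)).symmL ℝ (f q) (mvfderiv 𝓘(ℝ, E)
          (fun z ↦ (trivializationAt E' (TangentSpace 𝓘(ℝ, E') : P → Type _) (f q)
            (⟨f z, V z⟩ : TangentBundle 𝓘(ℝ, E') P)).2) q u))
      = T (f q) (fderiv ℝ (inChart p W) (chartAt E p q) (vecCoord p q u)) := by
    have e2 : (fun z ↦ (trivializationAt E' (TangentSpace 𝓘(ℝ, E') : P → Type _) (f q)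
        (⟨f z, V z⟩ : TangentBundle 𝓘(ℝ, E') P)).2) =ᶠ[𝓝 q] W := by
      filter_upwards [hnear] with z hz
      exact (vecCoord_apply hz _).symm
    have e3 : mvfderiv 𝓘(ℝ, E)
          (fun z ↦ (trivializationAt E' (TangentSpace 𝓘(ℝ, E') : P → Type _) (f q)
            (⟨f z, V z⟩ : TangentBundle 𝓘(ℝ, E') P)).2) q u = mvfderiv 𝓘(ℝ, E) W q u := by
      have := e2.mfderiv_eq (I := 𝓘(ℝ, E)) (I' := 𝓘(ℝ, E'))
      exact DFunLike.congr_fun this u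
    rw [e3, mvfderiv_eq_fderiv_inChart hq hW]
    rfl
  -- the product rule
  have hTf : DifferentiableAt ℝ (inChart p fun z ↦ T (f z)) (chartAt E p q) :=
    (mdifferentiableAt_iff_inChart hq _).1 (hTd.comp q hf)
  have hWf : DifferentiableAt ℝ (inChart p W) (chartAt E p q) :=
    (mdifferentiableAt_iff_inChart hq _).1 hW
  have e4 : alongInCharts f V p =ᶠ[𝓝 (chartAt E p q)]
      fun y ↦ (inChart p fun z ↦ T (f z)) y (inChart p W y) := by
    refine inChart_eventuallyEq hq (k := fun z ↦ T (f z) (W z)) ?_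
    filter_upwards [hnear] with z hz
    rw [hT, hWdef, ContinuousLinearMap.comp_apply, coordVec_vecCoord hz]
  have e5 : (inChart p ((fun z ↦ T z (W q)) ∘ f))
      = fun y : E ↦ (inChart p fun z ↦ T (f z)) y (W q) := rfl
  -- The coefficients in the fixed chart are `T W`. In the product rule, the derivative of `T`
  -- belongs to the constant-coefficient summand of the definition and the derivative of `W` to the
  -- other one.
  rw [e4.fderiv_eq, fderiv_clm_apply hTf hWf, covariantDerivativeAlong, map_add, h1, h2,
    vecCoord_mfderiv hq hfq hf, e5, fderiv_clm_apply hTf (differentiableAt_const _),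
    inChart_chartAt hq, inChart_chartAt hq]
  simp
  abel

end Along

/-! ### Covariant calculus along maps between vector spaces -/

section CoordinateCalculus

open Topology

variable {E : Type*} [NormedAddCommGroup E] [NormedSpace ℝ E]
  {E' : Type*} [NormedAddCommGroup E'] [NormedSpace ℝ E']

/-- The covariant derivative of the vector field `V` along `F`, for the connection with
Christoffel symbols `Γ`. -/
def covAlong (Γ : E' → E' →L[ℝ] E' →L[ℝ] E') (F V : E → E') (y u : E) : E' :=
  fderiv ℝ V y u + Γ (F y) (fderiv ℝ F y u) (V y)

theorem ContDiffAt.fderiv_apply_const {F : E → E'} {y : E} (hF : ContDiffAt ℝ ∞ F y) (v : E) :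
    ContDiffAt ℝ ∞ (fun z ↦ fderiv ℝ F z v) y :=
  (hF.fderiv_right (m := ∞) (by simp)).clm_apply contDiffAt_const

theorem ContDiffAt.covAlong {Γ : E' → E' →L[ℝ] E' →L[ℝ] E'} {F V : E → E'} {y : E}
    (hΓ : ContDiffAt ℝ ∞ Γ (F y)) (hF : ContDiffAt ℝ ∞ F y) (hV : ContDiffAt ℝ ∞ V y) (v : E) :
    ContDiffAt ℝ ∞ (fun z ↦ covAlong Γ F V z v) y :=
  (hV.fderiv_apply_const v).add
    (((hΓ.comp y hF).clm_apply (hF.fderiv_apply_const v)).clm_apply hV)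

theorem covAlong_congr {Γ : E' → E' →L[ℝ] E' →L[ℝ] E'} {F V W : E → E'} {y : E}
    (h : V =ᶠ[𝓝 y] W) (u : E) : covAlong Γ F V y u = covAlong Γ F W y u := by
  rw [covAlong, covAlong, h.fderiv_eq, h.self_of_nhds]

theorem fderiv_fderiv_apply {F : E → E'} {y : E} (hF : ContDiffAt ℝ ∞ F y) (u v : E) :
    fderiv ℝ (fun z ↦ fderiv ℝ F z v) y u = fderiv ℝ (fderiv ℝ F) y u v := by
  have h := (hF.fderiv_right (m := ∞) (by simp)).differentiableAt (by simp)
  rw [fderiv_clm_apply h (differentiableAt_const v)]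
  simp

theorem fderiv_fderiv_comm {F : E → E'} {y : E} (hF : ContDiffAt ℝ ∞ F y) (u v : E) :
    fderiv ℝ (fun z ↦ fderiv ℝ F z v) y u = fderiv ℝ (fun z ↦ fderiv ℝ F z u) y v := by
  rw [fderiv_fderiv_apply hF, fderiv_fderiv_apply hF]
  exact hF.isSymmSndFDerivAt (by simpa using ENat.LEInfty.out) u v

/-- The Ricci identity for vector fields along a map. -/
theorem covAlong_covAlong_sub {Γ : E' → E' →L[ℝ] E' →L[ℝ] E'} {F V : E → E'} {y : E}
    (hΓ : ContDiffAt ℝ ∞ Γ (F y)) (hF : ContDiffAt ℝ ∞ F y) (hV : ContDiffAt ℝ ∞ V y) (u v : E) :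
    covAlong Γ F (fun z ↦ covAlong Γ F V z v) y u - covAlong Γ F (fun z ↦ covAlong Γ F V z u) y v
      = coordCurvature Γ (F y) (fderiv ℝ F y u) (fderiv ℝ F y v) (V y) := by
  have hΓd := (hΓ.differentiableAt (by simp)).hasFDerivAt
  have hFd := (hF.differentiableAt (by simp)).hasFDerivAt
  have hVd := (hV.differentiableAt (by simp)).hasFDerivAt
  have key (a b : E) : fderiv ℝ (fun z ↦ covAlong Γ F V z b) y a
      = fderiv ℝ (fun z ↦ fderiv ℝ V z b) y a
        + (fderiv ℝ Γ (F y) (fderiv ℝ F y a) (fderiv ℝ F y b) (V y)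
        + Γ (F y) (fderiv ℝ (fun z ↦ fderiv ℝ F z b) y a) (V y)
        + Γ (F y) (fderiv ℝ F y b) (fderiv ℝ V y a)) := by
    have h1 := ((hV.fderiv_apply_const b).differentiableAt (by simp)).hasFDerivAt
    have h2 := ((hF.fderiv_apply_const b).differentiableAt (by simp)).hasFDerivAt
    have h3 := h1.add (((hΓd.comp y hFd).clm_apply h2).clm_apply hVd)
    have h4 : HasFDerivAt (fun z ↦ covAlong Γ F V z b) _ y := h3
    rw [h4.fderiv]
    simp
    abel
  have key' (a b : E) : covAlong Γ F (fun z ↦ covAlong Γ F V z b) y a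
      = fderiv ℝ (fun z ↦ covAlong Γ F V z b) y a
        + Γ (F y) (fderiv ℝ F y a) (fderiv ℝ V y b + Γ (F y) (fderiv ℝ F y b) (V y)) := rfl
  -- Second derivatives of `V` and of `F` are symmetric and cancel; the mixed terms `Γ(dF, dV)`
  -- occur in both orders and cancel as well.
  rw [key', key', key, key, fderiv_fderiv_comm hV u v, fderiv_fderiv_comm hF u v, coordCurvature]
  simp only [map_add]
  abel

variable {G : E' → E' →L[ℝ] E' →L[ℝ] ℝ} {Γ : E' → E' →L[ℝ] E' →L[ℝ] E'} {U : Set E'}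

theorem IsMetricConnectionOn.contDiffAt_connection (h : IsMetricConnectionOn G Γ U) {y : E'}
    (hy : y ∈ U) : ContDiffAt ℝ ∞ Γ y :=
  h.contDiffOn_connection.contDiffAt (h.isOpen.mem_nhds hy)

theorem IsMetricConnectionOn.contDiffAt_metric (h : IsMetricConnectionOn G Γ U) {y : E'}
    (hy : y ∈ U) : ContDiffAt ℝ ∞ G y :=
  h.contDiffOn_metric.contDiffAt (h.isOpen.mem_nhds hy)

/-- In the product rule, compatibility at `F y` in the direction `dF u` turns the derivative of `G`
into exactly the two Christoffel terms that complete `dV` and `dW` to covariant derivatives. -/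
theorem IsMetricConnectionOn.fderiv_metric_along (h : IsMetricConnectionOn G Γ U) {F V W : E → E'}
    {y : E} (hy : F y ∈ U) (hF : ContDiffAt ℝ ∞ F y) (hV : ContDiffAt ℝ ∞ V y)
    (hW : ContDiffAt ℝ ∞ W y) (u : E) :
    fderiv ℝ (fun z ↦ G (F z) (V z) (W z)) y u
      = G (F y) (covAlong Γ F V y u) (W y) + G (F y) (V y) (covAlong Γ F W y u) := by
  have hGd := ((h.contDiffAt_metric hy).differentiableAt (by simp)).hasFDerivAt
  have hFd := (hF.differentiableAt (by simp)).hasFDerivAt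
  have hVd := (hV.differentiableAt (by simp)).hasFDerivAt
  have hWd := (hW.differentiableAt (by simp)).hasFDerivAt
  have h1 : HasFDerivAt (fun z ↦ G (F z) (V z) (W z)) _ y :=
    ((hGd.comp y hFd).clm_apply hVd).clm_apply hWd
  rw [h1.fderiv]
  simp [covAlong, h.compatible _ hy]
  ring

theorem IsMetricConnectionOn.contDiffAt_metric_along (h : IsMetricConnectionOn G Γ U)
    {F V W : E → E'} {y : E} (hy : F y ∈ U) (hF : ContDiffAt ℝ ∞ F y) (hV : ContDiffAt ℝ ∞ V y)
    (hW : ContDiffAt ℝ ∞ W y) :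
    ContDiffAt ℝ ∞ (fun z ↦ G (F z) (V z) (W z)) y :=
  (((h.contDiffAt_metric hy).comp y hF).clm_apply hV).clm_apply hW

end CoordinateCalculus

/-! ### Symmetries of the curvature tensor -/

section CurvatureSymmetries

open Topology

variable {E : Type*} [NormedAddCommGroup E] [NormedSpace ℝ E]
  {G : E → E →L[ℝ] E →L[ℝ] ℝ} {Γ : E → E →L[ℝ] E →L[ℝ] E} {U : Set E}

theorem coordCurvature_swap (y u v w : E) :
    coordCurvature Γ y u v w = -coordCurvature Γ y v u w := by
  rw [coordCurvature, coordCurvature]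
  abel

/-- `Γ` is symmetric on an open set, so its derivative is symmetric in the same two arguments; all
terms of the cyclic sum then cancel in pairs. -/
theorem IsMetricConnectionOn.bianchi (h : IsMetricConnectionOn G Γ U) {y : E} (hy : y ∈ U)
    (u v w : E) :
    coordCurvature Γ y u v w + coordCurvature Γ y v w u + coordCurvature Γ y w u v = 0 := by
  have hs (a b c : E) : fderiv ℝ Γ y a b c = fderiv ℝ Γ y a c b := by
    have hd := ((h.contDiffAt_connection hy).differentiableAt (by simp))
    have e (b c : E) : fderiv ℝ (fun z ↦ Γ z b c) y a = fderiv ℝ Γ y a b c := by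
      rw [((hd.hasFDerivAt.clm_apply (hasFDerivAt_const b y)).clm_apply
        (hasFDerivAt_const c y)).fderiv]
      simp
    rw [← e, ← e]
    congr 1
    refine Filter.EventuallyEq.fderiv_eq ?_
    filter_upwards [h.isOpen.mem_nhds hy] with z hz
    exact h.connection_symm z hz b c
  have hg := h.connection_symm y hy
  rw [coordCurvature, coordCurvature, coordCurvature, hs u v w, hs v u w, hs w v u,
    hg w v, hg u w, hg v u]
  abel

/-- Second derivatives of the function `G(w, z)`, with `w` and `z` constant, commute. Expanding them
by compatibility, the products of first covariant derivatives cancel, and the Ricci identity along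
`id` identifies what is left with curvature. -/
theorem IsMetricConnectionOn.metric_curvature_skew (h : IsMetricConnectionOn G Γ U) {y : E}
    (hy : y ∈ U) (u v w z : E) :
    G y (coordCurvature Γ y u v w) z = -G y w (coordCurvature Γ y u v z) := by
  have hΓ := h.contDiffAt_connection hy
  have hi : ContDiffAt ℝ ∞ (id : E → E) y := contDiffAt_id
  have hc (a : E) (x : E) : ContDiffAt ℝ ∞ (fun _ : E ↦ a) x := contDiffAt_const
  have hcov (a b x : E) (hx : x ∈ U) : ContDiffAt ℝ ∞ (fun t ↦ covAlong Γ id (fun _ : E ↦ a) t b) x :=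
    ContDiffAt.covAlong (F := id) (h.contDiffAt_connection hx) contDiffAt_id (hc a x) b
  have hR (a : E) := covAlong_covAlong_sub (F := id) hΓ hi (hc a y) u v
  have hfirst (a x : E) (hx : x ∈ U) : fderiv ℝ (fun t ↦ G (id t) w z) x a
      = G x (covAlong Γ id (fun _ ↦ w) x a) z + G x w (covAlong Γ id (fun _ ↦ z) x a) :=
    h.fderiv_metric_along (F := id) hx contDiffAt_id (hc w x) (hc z x) a
  have hsecond (a b : E) : fderiv ℝ (fun x ↦ fderiv ℝ (fun t ↦ G (id t) w z) x b) y a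
      = G y (covAlong Γ id (fun t ↦ covAlong Γ id (fun _ ↦ w) t b) y a) z
        + G y (covAlong Γ id (fun _ ↦ w) y b) (covAlong Γ id (fun _ ↦ z) y a)
        + (G y (covAlong Γ id (fun _ ↦ w) y a) (covAlong Γ id (fun _ ↦ z) y b)
        + G y w (covAlong Γ id (fun t ↦ covAlong Γ id (fun _ ↦ z) t b) y a)) := by
    have e : (fun x ↦ fderiv ℝ (fun t ↦ G (id t) w z) x b) =ᶠ[𝓝 y]
        fun x ↦ G (id x) (covAlong Γ id (fun _ ↦ w) x b) z
          + G (id x) w (covAlong Γ id (fun _ ↦ z) x b) := by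
      filter_upwards [h.isOpen.mem_nhds hy] with x hx
      exact hfirst b x hx
    rw [e.fderiv_eq, fderiv_fun_add, _root_.add_apply,
      h.fderiv_metric_along (F := id) hy hi (hcov w b y hy) (hc z y),
      h.fderiv_metric_along (F := id) hy hi (hc w y) (hcov z b y hy)]
    · rfl
    · exact (h.contDiffAt_metric_along (F := id) hy hi (hcov w b y hy) (hc z y)).differentiableAt
        (by simp)
    · exact (h.contDiffAt_metric_along (F := id) hy hi (hc w y) (hcov z b y hy)).differentiableAt
        (by simp)
  have hcomm := fderiv_fderiv_comm
    (h.contDiffAt_metric_along (F := id) hy hi (hc w y) (hc z y)) u v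
  rw [hsecond, hsecond] at hcomm
  have hw := hR w
  have hz := hR z
  simp only [id, fderiv_id, ContinuousLinearMap.id_apply] at hw hz
  simp only at hcomm
  rw [← hw, ← hz, map_sub, map_sub, _root_.sub_apply]
  linarith

/-- The curvature commutes with a parallel field of endomorphisms. -/
theorem IsMetricConnectionOn.curvature_parallel (h : IsMetricConnectionOn G Γ U)
    {J : E → E →L[ℝ] E} (hJ : ContDiffOn ℝ ∞ J U)
    (hpar : ∀ y ∈ U, ∀ u v, fderiv ℝ J y u v + Γ y u (J y v) = J y (Γ y u v)) {y : E}
    (hy : y ∈ U) (u v w : E) :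
    coordCurvature Γ y u v (J y w) = J y (coordCurvature Γ y u v w) := by
  have hJa (x : E) (hx : x ∈ U) : ContDiffAt ℝ ∞ J x := hJ.contDiffAt (h.isOpen.mem_nhds hx)
  have hi : ContDiffAt ℝ ∞ (id : E → E) y := contDiffAt_id
  have hc (a : E) (x : E) : ContDiffAt ℝ ∞ (fun _ : E ↦ a) x := contDiffAt_const
  have hcov (a b x : E) (hx : x ∈ U) : ContDiffAt ℝ ∞ (fun t ↦ covAlong Γ id (fun _ : E ↦ a) t b) x :=
    ContDiffAt.covAlong (F := id) (h.contDiffAt_connection hx) contDiffAt_id (hc a x) b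
  -- Parallelism for non-constant fields: `∇(JV) = J∇V`. Used twice, it moves `J` out of both second
  -- derivatives in the Ricci identity.
  have hcomm (V : E → E) (x : E) (hx : x ∈ U) (hV : ContDiffAt ℝ ∞ V x) (a : E) :
      covAlong Γ id (fun t ↦ J t (V t)) x a = J x (covAlong Γ id V x a) := by
    rw [covAlong, covAlong, fderiv_clm_apply ((hJa x hx).differentiableAt (by simp))
      (hV.differentiableAt (by simp))]
    have := hpar x hx a (V x)
    simp only [id, fderiv_id, ContinuousLinearMap.id_apply, _root_.add_apply,
      ContinuousLinearMap.comp_apply, ContinuousLinearMap.flip_apply, map_add, ← this]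
    abel
  have hR1 := covAlong_covAlong_sub (F := id) (h.contDiffAt_connection hy) hi
    ((hJa y hy).clm_apply (hc w y)) u v
  have hR2 := covAlong_covAlong_sub (F := id) (h.contDiffAt_connection hy) hi (hc w y) u v
  have hloc (a b : E) : covAlong Γ id (fun z ↦ covAlong Γ id (fun t ↦ J t w) z b) y a
      = J y (covAlong Γ id (fun z ↦ covAlong Γ id (fun _ ↦ w) z b) y a) := by
    rw [← hcomm _ y hy (hcov w b y hy)]
    have e : (fun z ↦ covAlong Γ id (fun t ↦ J t w) z b) =ᶠ[𝓝 y]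
        fun z ↦ J z (covAlong Γ id (fun _ ↦ w) z b) := by
      filter_upwards [h.isOpen.mem_nhds hy] with x hx
      exact hcomm _ x hx (hc w x) b
    exact covAlong_congr e a
  rw [hloc, hloc, ← map_sub, hR2] at hR1
  simpa only [id, fderiv_id, ContinuousLinearMap.id_apply] using hR1.symm

end CurvatureSymmetries

/-! ### Hypersurfaces in coordinates: Gauss formula, Gauss and Codazzi equations -/

section CoordinateHypersurface

open Topology

variable {E : Type*} [NormedAddCommGroup E] [NormedSpace ℝ E]
  {E' : Type*} [NormedAddCommGroup E'] [NormedSpace ℝ E']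

/-- `F` is an isometric immersion of codimension one on the open set `O`, for the metric `g` on the
source and the metric `G` near the image, with unit normal field `N`. -/
structure IsIsometricHypersurfaceOn (g : E → E →L[ℝ] E →L[ℝ] ℝ) (G : E' → E' →L[ℝ] E' →L[ℝ] ℝ)
    (F N : E → E') (O : Set E) : Prop where
  isOpen : IsOpen O
  contDiffOn_map : ContDiffOn ℝ ∞ F O
  contDiffOn_normal : ContDiffOn ℝ ∞ N O
  isometric : ∀ y ∈ O, ∀ u v, G (F y) (fderiv ℝ F y u) (fderiv ℝ F y v) = g y u v
  normal : ∀ y ∈ O, ∀ u, G (F y) (N y) (fderiv ℝ F y u) = 0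
  unit : ∀ y ∈ O, G (F y) (N y) (N y) = 1
  spanning : ∀ y ∈ O, ∀ w, (∀ u, G (F y) w (fderiv ℝ F y u) = 0) → G (F y) w (N y) = 0 → w = 0

/-- The second fundamental form. -/
def secondForm (G : E' → E' →L[ℝ] E' →L[ℝ] ℝ) (Γ' : E' → E' →L[ℝ] E' →L[ℝ] E') (F N : E → E')
    (u v y : E) : ℝ :=
  -G (F y) (covAlong Γ' F N y u) (fderiv ℝ F y v)

variable {g : E → E →L[ℝ] E →L[ℝ] ℝ} {Γ : E → E →L[ℝ] E →L[ℝ] E} {U : Set E}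
  {G : E' → E' →L[ℝ] E' →L[ℝ] ℝ} {Γ' : E' → E' →L[ℝ] E' →L[ℝ] E'} {U' : Set E'}
  {F N : E → E'} {O : Set E} {y : E}

namespace IsIsometricHypersurfaceOn

theorem contDiffAt_map (h : IsIsometricHypersurfaceOn g G F N O) (hy : y ∈ O) :
    ContDiffAt ℝ ∞ F y := h.contDiffOn_map.contDiffAt (h.isOpen.mem_nhds hy)

theorem contDiffAt_normal (h : IsIsometricHypersurfaceOn g G F N O) (hy : y ∈ O) :
    ContDiffAt ℝ ∞ N y := h.contDiffOn_normal.contDiffAt (h.isOpen.mem_nhds hy)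

/-- Symmetry of the second derivative of `F`, together with vanishing torsion of the ambient
connection. -/
theorem covAlong_fderiv_comm (h : IsIsometricHypersurfaceOn g G F N O)
    (hG : IsMetricConnectionOn G Γ' U') (hO : Set.MapsTo F O U') (hy : y ∈ O) (u v : E) :
    covAlong Γ' F (fun z ↦ fderiv ℝ F z v) y u = covAlong Γ' F (fun z ↦ fderiv ℝ F z u) y v := by
  rw [covAlong, covAlong, fderiv_fderiv_comm (h.contDiffAt_map hy),
    hG.connection_symm _ (hO hy)]

theorem contDiffAt_secondForm (h : IsIsometricHypersurfaceOn g G F N O)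
    (hG : IsMetricConnectionOn G Γ' U') (hO : Set.MapsTo F O U') (hy : y ∈ O) (u v : E) :
    ContDiffAt ℝ ∞ (secondForm G Γ' F N u v) y :=
  (hG.contDiffAt_metric_along (hO hy) (h.contDiffAt_map hy)
    ((hG.contDiffAt_connection (hO hy)).covAlong (h.contDiffAt_map hy) (h.contDiffAt_normal hy) u)
    ((h.contDiffAt_map hy).fderiv_apply_const v)).neg

/-- Differentiate `G(N, dF v) = 0`. In this form the symmetry of the second fundamental form is
visible. -/
theorem secondForm_eq (h : IsIsometricHypersurfaceOn g G F N O)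
    (hG : IsMetricConnectionOn G Γ' U') (hO : Set.MapsTo F O U') (hy : y ∈ O) (u v : E) :
    secondForm G Γ' F N u v y = G (F y) (N y) (covAlong Γ' F (fun z ↦ fderiv ℝ F z v) y u) := by
  have h1 := hG.fderiv_metric_along (hO hy) (h.contDiffAt_map hy) (h.contDiffAt_normal hy)
    ((h.contDiffAt_map hy).fderiv_apply_const v) u
  have e : (fun z ↦ G (F z) (N z) (fderiv ℝ F z v)) =ᶠ[𝓝 y] fun _ ↦ 0 := by
    filter_upwards [h.isOpen.mem_nhds hy] with z hz
    exact h.normal z hz v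
  rw [e.fderiv_eq] at h1
  simp only [fderiv_fun_const, Pi.zero_apply, _root_.zero_apply] at h1
  rw [secondForm]
  linarith

theorem secondForm_symm (h : IsIsometricHypersurfaceOn g G F N O)
    (hG : IsMetricConnectionOn G Γ' U') (hO : Set.MapsTo F O U') (hy : y ∈ O) (u v : E) :
    secondForm G Γ' F N u v y = secondForm G Γ' F N v u y := by
  rw [h.secondForm_eq hG hO hy, h.secondForm_eq hG hO hy, h.covAlong_fderiv_comm hG hO hy]

theorem metric_covAlong_normal_self (h : IsIsometricHypersurfaceOn g G F N O)
    (hG : IsMetricConnectionOn G Γ' U') (hO : Set.MapsTo F O U') (hy : y ∈ O) (u : E) :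
    G (F y) (covAlong Γ' F N y u) (N y) = 0 := by
  have h1 := hG.fderiv_metric_along (hO hy) (h.contDiffAt_map hy) (h.contDiffAt_normal hy)
    (h.contDiffAt_normal hy) u
  have e : (fun z ↦ G (F z) (N z) (N z)) =ᶠ[𝓝 y] fun _ ↦ 1 := by
    filter_upwards [h.isOpen.mem_nhds hy] with z hz
    exact h.unit z hz
  rw [e.fderiv_eq] at h1
  simp only [fderiv_fun_const, Pi.zero_apply, _root_.zero_apply] at h1
  rw [hG.metric_symm _ (hO hy) (N y)] at h1
  linarith

/-- The hypothesis kills the tangential part of the derivative of `N`, and `G(N, N) = 1` kills its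
normal part; codimension one, in the form of `spanning`, leaves nothing else. -/
theorem covAlong_normal_eq_zero (h : IsIsometricHypersurfaceOn g G F N O)
    (hG : IsMetricConnectionOn G Γ' U') (hO : Set.MapsTo F O U') (hy : y ∈ O) {u : E}
    (hu : ∀ v, secondForm G Γ' F N u v y = 0) : covAlong Γ' F N y u = 0 :=
  h.spanning y hy _ (fun v ↦ neg_eq_zero.1 (hu v)) (h.metric_covAlong_normal_self hG hO hy u)

/-- The tangential part of the ambient connection is the connection of the induced metric. -/
theorem metric_covAlong_fderiv (h : IsIsometricHypersurfaceOn g G F N O)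
    (hg : IsMetricConnectionOn g Γ U) (hG : IsMetricConnectionOn G Γ' U')
    (hOU : O ⊆ U) (hO : Set.MapsTo F O U') (hy : y ∈ O) (u v w : E) :
    G (F y) (covAlong Γ' F (fun z ↦ fderiv ℝ F z v) y u) (fderiv ℝ F y w) = g y (Γ y u v) w := by
  -- The uniqueness argument for the Levi-Civita connection: the difference `T` is symmetric in its
  -- first two arguments and skew in the last two, hence zero.
  set T : E → E → E → ℝ := fun u v w ↦
    G (F y) (covAlong Γ' F (fun z ↦ fderiv ℝ F z v) y u) (fderiv ℝ F y w) - g y (Γ y u v) w with hT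
  have hsymm (u v w : E) : T u v w = T v u w := by
    simp only [hT]
    rw [h.covAlong_fderiv_comm hG hO hy, hg.connection_symm y (hOU hy)]
  have hskew (u v w : E) : T u v w = -T u w v := by
    have h1 := hG.fderiv_metric_along (hO hy) (h.contDiffAt_map hy)
      ((h.contDiffAt_map hy).fderiv_apply_const v) ((h.contDiffAt_map hy).fderiv_apply_const w) u
    have e : (fun z ↦ G (F z) (fderiv ℝ F z v) (fderiv ℝ F z w)) =ᶠ[𝓝 y] fun z ↦ g z v w := by
      filter_upwards [h.isOpen.mem_nhds hy] with z hz
      exact h.isometric z hz v w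
    have hd := ((hg.contDiffAt_metric (hOU hy)).differentiableAt (by simp)).hasFDerivAt
    rw [e.fderiv_eq, ((hd.clm_apply (hasFDerivAt_const v y)).clm_apply
      (hasFDerivAt_const w y)).fderiv] at h1
    have h2 := hg.compatible y (hOU hy) v w u
    simp only [ContinuousLinearMap.comp_zero, zero_add, ContinuousLinearMap.flip_apply] at h1
    rw [h2, hG.metric_symm _ (hO hy) (fderiv ℝ F y v), hg.metric_symm _ (hOU hy) v] at h1
    simp only [hT]
    linarith
  have hzero : T u v w = 0 := by
    have h1 := hsymm u v w
    have h2 := hskew v u w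
    have h3 := hsymm v w u
    have h4 := hskew w v u
    have h5 := hsymm w u v
    have h6 := hskew u w v
    linarith
  simp only [hT] at hzero
  linarith

/-- The Gauss formula. By `spanning` it suffices to compare tangential and normal components, which
`metric_covAlong_fderiv` and `secondForm_eq` compute. -/
theorem covAlong_fderiv (h : IsIsometricHypersurfaceOn g G F N O)
    (hg : IsMetricConnectionOn g Γ U) (hG : IsMetricConnectionOn G Γ' U')
    (hOU : O ⊆ U) (hO : Set.MapsTo F O U') (hy : y ∈ O) (u v : E) :
    covAlong Γ' F (fun z ↦ fderiv ℝ F z v) y u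
      = fderiv ℝ F y (Γ y u v) + secondForm G Γ' F N u v y • N y := by
  rw [← sub_eq_zero]
  refine h.spanning y hy _ (fun w ↦ ?_) ?_
  · simp only [map_sub, map_add, map_smul, _root_.sub_apply, _root_.add_apply, _root_.smul_apply,
      smul_eq_mul]
    rw [h.metric_covAlong_fderiv hg hG hOU hO hy, h.isometric y hy, h.normal y hy]
    ring
  · simp only [map_sub, map_add, map_smul, _root_.sub_apply, _root_.add_apply, _root_.smul_apply,
      smul_eq_mul]
    rw [hG.metric_symm _ (hO hy) (covAlong _ _ _ _ _), ← h.secondForm_eq hG hO hy,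
      hG.metric_symm _ (hO hy) (fderiv ℝ F y (Γ y u v)), h.normal y hy, h.unit y hy]
    ring

/-- The Gauss equation. -/
theorem gauss (h : IsIsometricHypersurfaceOn g G F N O)
    (hg : IsMetricConnectionOn g Γ U) (hG : IsMetricConnectionOn G Γ' U')
    (hOU : O ⊆ U) (hO : Set.MapsTo F O U') (hy : y ∈ O) (u v w z : E) :
    g y (coordCurvature Γ y u v w) z
      = G (F y) (coordCurvature Γ' (F y) (fderiv ℝ F y u) (fderiv ℝ F y v) (fderiv ℝ F y w))
          (fderiv ℝ F y z)
        + secondForm G Γ' F N v w y * secondForm G Γ' F N u z y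
        - secondForm G Γ' F N u w y * secondForm G Γ' F N v z y := by
  have hF := h.contDiffAt_map hy
  have hgd := ((hg.contDiffAt_metric (hOU hy)).differentiableAt (by simp)).hasFDerivAt
  have hΓd := ((hg.contDiffAt_connection (hOU hy)).differentiableAt (by simp)).hasFDerivAt
  -- Differentiating the scalar identity `G(∇_v dF w, dF z) = g(Γ(v, w), z)` gives the tangential
  -- part of the second derivative; the product of second fundamental forms is the pairing of the
  -- two normal parts in the Gauss formula.
  have key (u v : E) :
      G (F y) (covAlong Γ' F (fun t ↦ covAlong Γ' F (fun t ↦ fderiv ℝ F t w) t v) y u)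
          (fderiv ℝ F y z)
        = g y (fderiv ℝ Γ y u v w + Γ y u (Γ y v w)) z
          - secondForm G Γ' F N v w y * secondForm G Γ' F N u z y := by
    have h1 := hG.fderiv_metric_along (hO hy) hF
      ((hG.contDiffAt_connection (hO hy)).covAlong hF (hF.fderiv_apply_const w) v)
      (hF.fderiv_apply_const z) u
    have e : (fun t ↦ G (F t) (covAlong Γ' F (fun t ↦ fderiv ℝ F t w) t v) (fderiv ℝ F t z))
        =ᶠ[𝓝 y] fun t ↦ g t (Γ t v w) z := by
      filter_upwards [h.isOpen.mem_nhds hy] with t ht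
      exact h.metric_covAlong_fderiv hg hG hOU hO ht v w z
    rw [e.fderiv_eq, ((hgd.clm_apply ((hΓd.clm_apply (hasFDerivAt_const v y)).clm_apply
      (hasFDerivAt_const w y))).clm_apply (hasFDerivAt_const z y)).fderiv,
      h.covAlong_fderiv hg hG hOU hO hy v w, h.covAlong_fderiv hg hG hOU hO hy u z] at h1
    simp only [ContinuousLinearMap.comp_zero, zero_add, ContinuousLinearMap.flip_apply,
      _root_.add_apply, ContinuousLinearMap.comp_apply, map_add, map_smul, _root_.smul_apply,
      smul_eq_mul] at h1
    rw [hg.compatible y (hOU hy), h.isometric y hy, h.normal y hy, h.unit y hy,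
      hG.metric_symm _ (hO hy) (fderiv ℝ F y (Γ y v w)) (N y), h.normal y hy] at h1
    simp only [map_add, _root_.add_apply]
    linarith
  have hR := covAlong_covAlong_sub (hG.contDiffAt_connection (hO hy)) hF
    (hF.fderiv_apply_const w) u v
  rw [← hR, map_sub, _root_.sub_apply, key, key, coordCurvature]
  simp only [map_add, map_sub, _root_.add_apply, _root_.sub_apply]
  ring

/-- The Codazzi equation in directions in the kernel of the shape operator. -/
theorem codazzi_of_eq_zero (h : IsIsometricHypersurfaceOn g G F N O)
    (hG : IsMetricConnectionOn G Γ' U') (hO : Set.MapsTo F O U') (hy : y ∈ O) {u v : E}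
    (hu : ∀ w, secondForm G Γ' F N u w y = 0) (hv : ∀ w, secondForm G Γ' F N v w y = 0) (z : E) :
    G (F y) (coordCurvature Γ' (F y) (fderiv ℝ F y u) (fderiv ℝ F y v) (N y)) (fderiv ℝ F y z)
      = fderiv ℝ (secondForm G Γ' F N u z) y v - fderiv ℝ (secondForm G Γ' F N v z) y u := by
  have hF := h.contDiffAt_map hy
  have hN := h.contDiffAt_normal hy
  -- As `∇_b N = 0` at `y`, the term `G(∇_b N, ∇_a dF z)` disappears from the product rule, so no
  -- Christoffel corrections of the hypersurface are needed.
  have key (a b : E) (hb : ∀ w, secondForm G Γ' F N b w y = 0) :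
      fderiv ℝ (secondForm G Γ' F N b z) y a
        = -G (F y) (covAlong Γ' F (fun t ↦ covAlong Γ' F N t b) y a) (fderiv ℝ F y z) := by
    have h1 := hG.fderiv_metric_along (hO hy) hF
      ((hG.contDiffAt_connection (hO hy)).covAlong hF hN b) (hF.fderiv_apply_const z) a
    rw [h.covAlong_normal_eq_zero hG hO hy hb, map_zero, _root_.zero_apply, add_zero] at h1
    rw [← h1]
    have e : secondForm G Γ' F N b z
        = fun t ↦ -G (F t) (covAlong Γ' F N t b) (fderiv ℝ F t z) := rfl
    rw [e, fderiv_fun_neg, _root_.neg_apply]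
  rw [key u v hv, key v u hu, ← covAlong_covAlong_sub (hG.contDiffAt_connection (hO hy)) hF hN,
    map_sub, _root_.sub_apply]
  ring

end IsIsometricHypersurfaceOn

end CoordinateHypersurface

/-! ### Algebraic curvature tensors and polarization -/

section CurvatureLike

variable {V : Type*} [AddCommGroup V]

/-- An algebraic curvature tensor (with the symmetries of a curvature tensor) is determined by the
sectional curvatures. -/
theorem curvatureLike_eq_zero_of_sectional {T : V → V → V → V → ℝ}
    (hadd : ∀ x x' y z w, T (x + x') y z w = T x y z w + T x' y z w)
    (hskew : ∀ x y z w, T x y z w = -T y x z w)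
    (hbianchi : ∀ x y z w, T x y z w + T y z x w + T z x y w = 0)
    (hpair : ∀ x y z w, T x y z w = T z w x y)
    (hsec : ∀ x y, T x y x y = 0) (x y z w : V) : T x y z w = 0 := by
  have hadd2 (x y y' z w : V) : T x (y + y') z w = T x y z w + T x y' z w := by
    rw [hskew, hadd, hskew y, hskew y']
    ring
  have hadd3 (x y z z' w : V) : T x y (z + z') w = T x y z w + T x y z' w := by
    rw [hpair, hadd, hpair z, hpair z']
  have hadd4 (x y z w w' : V) : T x y z (w + w') = T x y z w + T x y z w' := by
    rw [hpair, hadd2, hpair z, hpair z w']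
  have h1 (x y w : V) : T x y x w = 0 := by
    have h := hsec x (y + w)
    rw [hadd2, hadd4, hadd4, hsec, hsec, hpair x w] at h
    linarith
  -- After polarizing in `y` and then in `x`, `T` is alternating in its first three arguments, so
  -- the Bianchi sum equals `3T`.
  have h2 (x y z w : V) : T x y z w = -T z y x w := by
    have h := h1 (x + z) y w
    rw [hadd, hadd3, hadd3, h1, h1] at h
    linarith
  have h3 := hbianchi x y z w
  have h4 := h2 x y z w
  have h5 := h2 z x y w
  have h6 := hskew z y x w
  have h7 := hskew y x z w
  linarith

/-- A `J`-invariant algebraic curvature tensor is determined by the holomorphic sectional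
curvatures. -/
theorem curvatureLike_eq_zero_of_holomorphic {T : V → V → V → V → ℝ} {J : V →+ V}
    (hJ : ∀ x, J (J x) = -x)
    (hadd : ∀ x x' y z w, T (x + x') y z w = T x y z w + T x' y z w)
    (hskew : ∀ x y z w, T x y z w = -T y x z w)
    (hskew' : ∀ x y z w, T x y z w = -T x y w z)
    (hbianchi : ∀ x y z w, T x y z w + T y z x w + T z x y w = 0)
    (hTJ : ∀ x y z w, T x y (J z) (J w) = T x y z w)
    (hhol : ∀ x, T x (J x) x (J x) = 0) (x y z w : V) : T x y z w = 0 := by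
  -- Pair symmetry from four Bianchi identities and skewness in each pair.
  have hpair (x y z w : V) : T x y z w = T z w x y := by
    have b1 := hbianchi x y z w
    have b2 := hbianchi y z w x
    have b3 := hbianchi z w x y
    have b4 := hbianchi w x y z
    have s1 := hskew' y z w x
    have s2 := hskew' z w y x
    have s3 := hskew' w y z x
    have s4 := hskew w y x z
    have s5 := hskew' y w x z
    have s6 := hskew' z x w y
    have s7 := hskew' x y w z
    have s8 := hskew' z x y w
    have s9 := hskew' y w z x
    have s10 := hskew w y z x
    have s11 := hskew' w x z y
    have s12 := hskew' w x y z
    have s13 := hskew' z w x y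
    have s14 := hskew x z w y
    linarith
  have hadd2 (x y y' z w : V) : T x (y + y') z w = T x y z w + T x y' z w := by
    rw [hskew, hadd, hskew y, hskew y']
    ring
  have hadd3 (x y z z' w : V) : T x y (z + z') w = T x y z w + T x y z' w := by
    rw [hpair, hadd, hpair z, hpair z']
  have hadd4 (x y z w w' : V) : T x y z (w + w') = T x y z w + T x y z w' := by
    rw [hpair, hadd2, hpair z, hpair z w']
  have hneg4 (x y z w : V) : T x y z (-w) = -T x y z w := by
    have h0 := hadd4 x y z 0 0
    have h := hadd4 x y z w (-w)
    rw [add_neg_cancel] at h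
    rw [add_zero] at h0
    linarith
  have hneg2 (x y z w : V) : T x (-y) z w = -T x y z w := by rw [hpair, hneg4, hpair]
  have hneg1 (x y z w : V) : T (-x) y z w = -T x y z w := by rw [hskew, hneg2, ← hskew]
  have hneg3 (x y z w : V) : T x y (-z) w = -T x y z w := by rw [hpair, hneg1, hpair]
  have hTJ' (x y z w : V) : T (J x) (J y) z w = T x y z w := by rw [hpair, hTJ, hpair]
  have hTJ3 (x y z w : V) : T x y (J z) w = -T x y z (J w) := by
    rw [← hTJ x y (J z) w, hJ, hneg3]
  have hTJ1 (x y z w : V) : T (J x) y z w = -T x (J y) z w := by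
    rw [hpair, hTJ3, hpair]
  -- Adding the holomorphic conditions at `x + y` and `x - y` keeps the terms of degree two in each
  -- variable: `4 T(x, Jy, x, Jy) + 2 T(x, Jx, y, Jy) = 0`. By Bianchi, `T(x, Jx, y, Jy) = T(x, Jy,
  -- x, Jy) + T(x, y, x, y)`.
  have key (x y : V) : 3 * T x (J y) x (J y) + T x y x y = 0 := by
    have h1 := hhol (x + y)
    have h2 := hhol (x + -y)
    simp only [map_add, map_neg, hadd, hadd2, hadd3, hadd4, hneg1, hneg2, hneg3, hneg4, hhol]
      at h1 h2
    have b1 := hbianchi x (J x) y (J y)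
    have e1 : T (J x) y x (J y) = -T x (J y) x (J y) := hTJ1 ..
    have e2 : T y x (J x) (J y) = - T x y x y := by rw [hTJ, hskew]
    have e3 : T y (J x) y (J x) = T x (J y) x (J y) := by
      rw [hpair, ← hTJ', hJ, hneg2, hskew, ← hTJ, hJ, hneg4, hskew']
      ring
    have e4 : T y (J x) x (J y) = T x (J y) x (J y) := by
      rw [← hTJ', hJ, hneg2, hskew, neg_neg]
    have e5 : T x (J y) y (J x) = T x (J y) x (J y) := by
      rw [hpair, e4]
    have e6 : T y (J y) x (J x) = T x (J x) y (J y) := hpair ..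
    rw [e3, e4, e5, e6] at h1 h2
    have e7 : T y x (J x) (J y) = - T x y x y := e2
    have b2 : T y x (J x) (J y) + T (J x) y x (J y) + T x (J x) y (J y) = 0 := by linarith
    linarith
  refine curvatureLike_eq_zero_of_sectional hadd hskew hbianchi hpair (fun x y ↦ ?_) x y z w
  -- Replacing `y` by `Jy` exchanges the two unknowns `T(x, y, x, y)` and `T(x, Jy, x, Jy)`; the two
  -- relations together force both to vanish.
  have h1 := key x y
  have h2 := key x (J y)
  rw [hJ, hneg2, hneg4] at h2
  linarith

end CurvatureLike

/-! ### Linear algebra of the shape operator at a non-principal point -/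

section Pointwise

variable {T : Type*} [NormedAddCommGroup T] [InnerProductSpace ℝ T]

/-- A codimension one isometric linear map is onto the orthogonal complement of the normal. -/
theorem exists_apply_eq_of_inner_normal_eq_zero {T' : Type*} [NormedAddCommGroup T']
    [InnerProductSpace ℝ T'] [FiniteDimensional ℝ T] [FiniteDimensional ℝ T']
    (hrank : Module.finrank ℝ T' = Module.finrank ℝ T + 1) {D : T →ₗ[ℝ] T'}
    (hD : ∀ u v, inner ℝ (D u) (D v) = inner ℝ u v) {n : T'} (hn0 : n ≠ 0)
    (hn : ∀ u, inner ℝ n (D u) = 0) {w : T'} (hw : inner ℝ n w = 0) : ∃ u, D u = w := by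
  have hinj : Function.Injective D := (injective_iff_map_eq_zero _).2 fun u hu ↦ by
    have := hD u u
    rw [hu, inner_zero_left] at this
    exact inner_self_eq_zero.1 this.symm
  have hle : LinearMap.range D ≤ (Submodule.span ℝ {n})ᗮ := by
    rintro _ ⟨u, rfl⟩
    exact Submodule.mem_orthogonal_singleton_iff_inner_right.2 (hn u)
  have hfin : Module.finrank ℝ (LinearMap.range D)
      = Module.finrank ℝ (Submodule.span ℝ {n})ᗮ := by
    have h1 := LinearMap.finrank_range_of_inj hinj
    have h2 := (Submodule.span ℝ {n}).finrank_add_finrank_orthogonal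
    rw [finrank_span_singleton hn0] at h2
    lia
  have := Submodule.eq_of_le_of_finrank_eq hle hfin
  have hw' : w ∈ LinearMap.range D := by
    rw [this]
    exact Submodule.mem_orthogonal_singleton_iff_inner_right.2 hw
  exact hw'

/-- The Gauss equation of a hypersurface with nullity condition, at a point where the structure
vector is not principal: a vector `V` orthogonal to `ξ` and `v = A ξ - ⟨A ξ, ξ⟩ ξ` is in the kernel
of the shape operator `A`, and `A` has rank one. -/
theorem rank_one_of_nullity {A : T →ₗ[ℝ] T} {ξ v V : T} {μ : ℝ}
    (hA : ∀ x y, inner ℝ (A x) y = inner ℝ x (A y)) (hξ : inner ℝ ξ ξ = 1)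
    (hv : v = A ξ - inner ℝ (A ξ) ξ • ξ) (hv0 : v ≠ 0) (hV0 : V ≠ 0)
    (hVξ : inner ℝ V ξ = 0) (hVv : inner ℝ V v = 0)
    (hgauss : ∀ X Y Z, μ * (inner ℝ Y ξ * inner ℝ X Z - inner ℝ X ξ * inner ℝ Y Z)
      = inner ℝ (A Y) ξ * inner ℝ (A X) Z - inner ℝ (A X) ξ * inner ℝ (A Y) Z) :
    A V = 0 ∧ inner ℝ v ξ = 0 ∧ inner ℝ (A ξ) ξ ≠ 0 ∧ inner ℝ (A v) v ≠ 0 ∧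
      A (inner ℝ v v • ξ - inner ℝ (A ξ) ξ • v) = 0 ∧
      ∀ X Y Z W, inner ℝ (A X) Z * inner ℝ (A Y) W = inner ℝ (A X) W * inner ℝ (A Y) Z := by
  have hvξ : inner ℝ v ξ = 0 := by
    rw [hv, inner_sub_left, real_inner_smul_left, hξ]
    ring
  have hθ (x : T) : inner ℝ (A x) ξ = inner ℝ x v + inner ℝ (A ξ) ξ * inner ℝ x ξ := by
    rw [hv, inner_sub_right, inner_smul_right, hA]
    ring
  have hvv : inner ℝ v v ≠ 0 := inner_self_ne_zero.2 hv0
  have hθv : inner ℝ (A v) ξ = inner ℝ v v := by rw [hθ, hvξ]; ring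
  have hθV : inner ℝ (A V) ξ = 0 := by rw [hθ, hVv, hVξ]; ring
  have hAV : A V = 0 := ext_inner_right ℝ fun Z ↦ by
    have h := hgauss V v Z
    rw [hvξ, hVξ, hθv, hθV] at h
    rw [inner_zero_left]
    refine (mul_eq_zero.1 ?_).resolve_left hvv
    linarith
  -- With `X = Z = V` and `Y = ξ` the left side is `μ|V|²`, and the right side vanishes since `AV =
  -- 0`.
  have hμ : μ = 0 := by
    have h := hgauss V ξ V
    rw [hAV, hξ, hVξ, inner_zero_left, inner_zero_left] at h
    refine (mul_eq_zero.1 ?_).resolve_right (inner_self_ne_zero (𝕜 := ℝ).2 hV0)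
    linarith
  have hrel (X Y Z : T) :
      inner ℝ (A Y) ξ * inner ℝ (A X) Z = inner ℝ (A X) ξ * inner ℝ (A Y) Z := by
    have h := hgauss X Y Z
    rw [hμ] at h
    linarith
  -- This reads `⟨Aξ, ξ⟩⟨Av, v⟩ = |v|⁴`, so neither factor on the left is zero.
  have h1 := hrel v ξ v
  have h2 : inner ℝ (A ξ) v = inner ℝ v v := by rw [hA, real_inner_comm, hθv]
  rw [hθv, h2] at h1
  have h3 := mul_ne_zero hvv hvv
  rw [← h1] at h3
  refine ⟨hAV, hvξ, left_ne_zero_of_mul h3, right_ne_zero_of_mul h3, ?_, fun X Y Z W ↦ ?_⟩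
  · refine ext_inner_right ℝ fun Z ↦ ?_
    have h := hrel ξ v Z
    rw [hθv] at h
    rw [map_sub, map_smul, map_smul, inner_sub_left, real_inner_smul_left, real_inner_smul_left,
      inner_zero_left]
    linarith
  · refine mul_left_cancel₀ (mul_ne_zero hvv hvv) ?_
    have a1 := hrel X v Z
    have a2 := hrel Y v W
    have a3 := hrel X v W
    have a4 := hrel Y v Z
    rw [hθv] at a1 a2 a3 a4
    calc _ = (inner ℝ v v * inner ℝ (A X) Z) * (inner ℝ v v * inner ℝ (A Y) W) := by ring
      _ = (inner ℝ v v * inner ℝ (A X) W) * (inner ℝ v v * inner ℝ (A Y) Z) := by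
        rw [a1, a2, a3, a4]; ring
      _ = _ := by ring

end Pointwise

/-! ### The curvature tensor of a complex space form -/

section ComplexSpaceForm

open Topology

/-- The curvature of a complex space form, from its holomorphic sectional curvature, for a single
tangent space with inner product `G`, complex structure `J` and curvature tensor `R`. -/
theorem curvature_eq_of_holomorphic {V : Type*} [NormedAddCommGroup V] [NormedSpace ℝ V]
    {G : V →L[ℝ] V →L[ℝ] ℝ} {J : V →L[ℝ] V} {R : V → V → V → V} {c : ℝ}
    (hG : ∀ u v, G u v = G v u) (hJ : ∀ u, J (J u) = -u) (hGJ : ∀ u v, G (J u) (J v) = G u v)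
    (hadd : ∀ x x' y z, R (x + x') y z = R x y z + R x' y z)
    (hskew : ∀ x y z, R x y z = -R y x z)
    (hskew' : ∀ x y z w, G (R x y z) w = -G z (R x y w))
    (hbianchi : ∀ x y z, R x y z + R y z x + R z x y = 0)
    (hRJ : ∀ x y z, R x y (J z) = J (R x y z))
    (hhol : ∀ x, G (R x (J x) (J x)) x = c * G x x ^ 2) (x y z w : V) :
    G (R x y z) w = c / 4 * (G y z * G x w - G x z * G y w + G (J y) z * G (J x) w
      - G (J x) z * G (J y) w - 2 * G (J x) y * G (J z) w) := by
  have hGJ' (u v : V) : G (J u) v = -G u (J v) := by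
    rw [← hGJ u (J v), hJ, map_neg]
    ring
  have hJself (u : V) : G (J u) u = 0 := by
    have := hGJ' u u
    rw [hG u] at this
    linarith
  rw [← sub_eq_zero]
  -- `T` is the difference between the given curvature and the model one. Both have all the Kähler
  -- curvature symmetries and the same holomorphic sectional curvature.
  refine curvatureLike_eq_zero_of_holomorphic (J := (J : V →+ V))
    (T := fun x y z w ↦ G (R x y z) w - c / 4 * (G y z * G x w - G x z * G y w
      + G (J y) z * G (J x) w - G (J x) z * G (J y) w - 2 * G (J x) y * G (J z) w))
    hJ ?_ ?_ ?_ ?_ ?_ ?_ x y z w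
  · intro x x' y z w
    simp only [hadd, map_add, _root_.add_apply]
    ring
  · intro x y z w
    rw [hskew x y z, map_neg, _root_.neg_apply, hGJ' x y, hG x (J y)]
    ring
  · intro x y z w
    rw [hskew' x y z w, hG z (R x y w), hGJ' z w, hG z]
    ring
  · intro x y z w
    have h := congrArg (fun v ↦ G v w) (hbianchi x y z)
    simp only [map_add, _root_.add_apply, map_zero, _root_.zero_apply] at h
    have e1 := hGJ' y x
    have e2 := hGJ' z x
    have e3 := hGJ' z y
    rw [hG y] at e1
    rw [hG z] at e2 e3
    rw [e1, e2, e3, hG y x, hG z x, hG z y]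
    linear_combination h
  · intro x y z w
    have e (u v : V) : G u (J v) = -G (J u) v := by rw [hGJ', neg_neg]
    have h : G (R x y (J z)) (J w) = G (R x y z) w := by rw [hRJ, hGJ]
    change G (R x y (J z)) (J w) - c / 4 * (G y (J z) * G x (J w) - G x (J z) * G y (J w)
      + G (J y) (J z) * G (J x) (J w) - G (J x) (J z) * G (J y) (J w)
      - 2 * G (J x) y * G (J (J z)) (J w)) = _
    rw [h, hJ, hGJ, hGJ, hGJ, hGJ, e, e, e, e, map_neg, _root_.neg_apply, hGJ' z w]
    ring
  · intro x
    change G (R x (J x) x) (J x) - c / 4 * (G (J x) x * G x (J x) - G x x * G (J x) (J x)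
      + G (J (J x)) x * G (J x) (J x) - G (J x) x * G (J (J x)) (J x)
      - 2 * G (J x) (J x) * G (J x) (J x)) = 0
    have h := hhol x
    rw [hskew', hG (J x)] at h
    rw [hJ, hGJ, map_neg, _root_.neg_apply, hJself]
    linear_combination -h

variable {E : Type*} [NormedAddCommGroup E] [NormedSpace ℝ E] [FiniteDimensional ℝ E]
  {P : Type*} [TopologicalSpace P] [ChartedSpace E P] [IsManifold 𝓘(ℝ, E) ∞ P]

/-- A field of endomorphisms of the tangent spaces at `x`, in the chart at `x₀`. -/
def endCoeff (J : Π x : P, TangentSpace 𝓘(ℝ, E) x →L[ℝ] TangentSpace 𝓘(ℝ, E) x) (x₀ x : P) :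
    E →L[ℝ] E :=
  (vecCoord x₀ x).comp ((J x).comp (coordVec x₀ x))

variable {J : Π x : P, TangentSpace 𝓘(ℝ, E) x →L[ℝ] TangentSpace 𝓘(ℝ, E) x}

omit [FiniteDimensional ℝ E] in
theorem endCoeff_vecCoord {x₀ x : P} (hx : x ∈ (chartAt E x₀).source)
    (u : TangentSpace 𝓘(ℝ, E) x) :
    endCoeff J x₀ x (vecCoord x₀ x u) = vecCoord x₀ x (J x u) := by
  rw [endCoeff, ContinuousLinearMap.comp_apply, ContinuousLinearMap.comp_apply,
    coordVec_vecCoord hx]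

variable [RiemannianBundle (fun x : P ↦ TangentSpace 𝓘(ℝ, E) x)] in
theorem metricCoeff_coordCurvature
    (cov : CovariantDerivative 𝓘(ℝ, E) E (TangentSpace 𝓘(ℝ, E) : P → Type _)) {x₀ : P}
    (hΓ : DifferentiableAt ℝ (inChart x₀ (christoffel cov x₀)) (chartAt E x₀ x₀))
    (u v w z : TangentSpace 𝓘(ℝ, E) x₀) :
    metricCoeff x₀ x₀ (coordCurvature (inChart x₀ (christoffel cov x₀)) (chartAt E x₀ x₀)
      (vecCoord x₀ x₀ u) (vecCoord x₀ x₀ v) (vecCoord x₀ x₀ w)) (vecCoord x₀ x₀ z)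
      = inner ℝ (curvatureTensor cov x₀ u v w) z := by
  have hx := mem_chart_source E x₀
  have h := vecCoord_curvatureTensor cov hΓ (vecCoord x₀ x₀ u) (vecCoord x₀ x₀ v)
    (vecCoord x₀ x₀ w)
  rw [coordVec_vecCoord hx, coordVec_vecCoord hx, coordVec_vecCoord hx] at h
  rw [← h, metricCoeff_vecCoord hx]

variable [RiemannianBundle (fun x : P ↦ TangentSpace 𝓘(ℝ, E) x)]
  {cov : CovariantDerivative 𝓘(ℝ, E) E (TangentSpace 𝓘(ℝ, E) : P → Type _)}

namespace IsKaehlerStructure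

omit [FiniteDimensional ℝ E] in
theorem contMDiffAt_endCoeff_apply (hJ : IsKaehlerStructure cov J) {x₀ x : P}
    (hx : x ∈ (chartAt E x₀).source) (u : E) :
    ContMDiffAt 𝓘(ℝ, E) 𝓘(ℝ, E) ∞ (fun y ↦ endCoeff J x₀ y u) x := by
  have h := ContMDiffAt.clm_bundle_apply (hJ.smooth x) (contMDiffAt_coordVec (n := ⊤) hx u)
  exact (contMDiffAt_vectorField_iff (n := ⊤) hx _).1 h

theorem contDiffOn_endCoeff (hJ : IsKaehlerStructure cov J) (x₀ : P) :
    ContDiffOn ℝ ∞ (inChart x₀ (endCoeff J x₀)) (chartAt E x₀).target := by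
  refine contDiffOn_clm_apply.2 fun u ↦ fun y hy ↦ ?_
  have hx := (chartAt E x₀).map_target hy
  have := (contMDiffAt_iff_inChart (n := ⊤) hx _).1 (hJ.contMDiffAt_endCoeff_apply hx u)
  rw [(chartAt E x₀).right_inv hy] at this
  exact this.contDiffWithinAt

/-- `∇J = 0` evaluated on a coordinate field; this is the form required by `curvature_parallel`. -/
theorem endCoeff_parallel (hJ : IsKaehlerStructure cov J) (x₀ : P) {y : E}
    (hy : y ∈ (chartAt E x₀).target) (u v : E) :
    fderiv ℝ (inChart x₀ (endCoeff J x₀)) y u v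
        + inChart x₀ (christoffel cov x₀) y u (inChart x₀ (endCoeff J x₀) y v)
      = inChart x₀ (endCoeff J x₀) y (inChart x₀ (christoffel cov x₀) y u v) := by
  have hx := (chartAt E x₀).map_target hy
  have h := hJ.parallel _ _ (mdifferentiableAt_coordVec hx v) (coordVec x₀ ((chartAt E x₀).symm y) u)
  have hs := (hJ.contMDiffAt_endCoeff_apply hx v).mdifferentiableAt (by simp)
  have hY := (mdifferentiableAt_vectorField_iff hx
    (fun z ↦ J z (coordVec x₀ z v))).2 hs
  have h1 := vecCoord_cov cov hx hY u
  rw [(chartAt E x₀).right_inv hy] at h1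
  have hd := (((hJ.contDiffOn_endCoeff x₀).contDiffAt
    ((chartAt E x₀).open_target.mem_nhds hy)).differentiableAt (by simp)).hasFDerivAt
  have e : (inChart x₀ fun z ↦ vecCoord x₀ z (J z (coordVec x₀ z v)))
      = fun z : E ↦ inChart x₀ (endCoeff J x₀) z v := rfl
  rw [e, (hd.clm_apply (hasFDerivAt_const v y)).fderiv] at h1
  simp only [ContinuousLinearMap.comp_zero, zero_add, ContinuousLinearMap.flip_apply] at h1
  refine h1.symm.trans ((congrArg (vecCoord x₀ _) h).trans ?_)
  rw [← endCoeff_vecCoord hx, ← christoffel_apply cov hx]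
  rfl

variable [IsContMDiffRiemannianBundle 𝓘(ℝ, E) ∞ E (fun x : P ↦ TangentSpace 𝓘(ℝ, E) x)]

/-- The curvature tensor of a complex space form, in coordinates. -/
theorem coordCurvature_eq (hJ : IsKaehlerStructure cov J) (hcov : IsLeviCivita cov) {c : ℝ}
    (hc : HasConstantHolomorphicSectionalCurvature cov J c) (x₀ : P) (x y z w : E) :
    metricCoeff x₀ x₀ (coordCurvature (inChart x₀ (christoffel cov x₀)) (chartAt E x₀ x₀) x y z) w
      = c / 4 * (metricCoeff x₀ x₀ y z * metricCoeff x₀ x₀ x w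
        - metricCoeff x₀ x₀ x z * metricCoeff x₀ x₀ y w
        + metricCoeff x₀ x₀ (endCoeff J x₀ x₀ y) z * metricCoeff x₀ x₀ (endCoeff J x₀ x₀ x) w
        - metricCoeff x₀ x₀ (endCoeff J x₀ x₀ x) z * metricCoeff x₀ x₀ (endCoeff J x₀ x₀ y) w
        - 2 * metricCoeff x₀ x₀ (endCoeff J x₀ x₀ x) y
          * metricCoeff x₀ x₀ (endCoeff J x₀ x₀ z) w) := by
  have hx := mem_chart_source E x₀
  have hy := mem_chart_target E x₀
  have hΓ := hcov.isMetricConnectionOn x₀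
  have hJd := hJ.contDiffOn_endCoeff x₀
  have eG : inChart x₀ (metricCoeff (E := E) x₀) (chartAt E x₀ x₀) = metricCoeff x₀ x₀ :=
    inChart_chartAt hx _
  have eJ : inChart x₀ (endCoeff J x₀) (chartAt E x₀ x₀) = endCoeff J x₀ x₀ :=
    inChart_chartAt hx _
  refine curvature_eq_of_holomorphic (G := metricCoeff x₀ x₀) (J := endCoeff J x₀ x₀)
    (R := coordCurvature (inChart x₀ (christoffel cov x₀)) (chartAt E x₀ x₀))
    (fun u v ↦ ?_) (fun u ↦ ?_) (fun u v ↦ ?_) (fun x x' y z ↦ ?_)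
    (fun x y z ↦ coordCurvature_swap ..) (fun x y z w ↦ ?_) (fun x y z ↦ hΓ.bianchi hy x y z)
    (fun x y z ↦ ?_) (fun x ↦ ?_) x y z w
  · rw [← eG, hΓ.metric_symm _ hy]
  · rw [← vecCoord_coordVec hx u, endCoeff_vecCoord hx, endCoeff_vecCoord hx, hJ.sq, map_neg]
  · rw [← vecCoord_coordVec hx u, ← vecCoord_coordVec hx v, endCoeff_vecCoord hx,
      endCoeff_vecCoord hx, metricCoeff_vecCoord hx, metricCoeff_vecCoord hx, hJ.isometric]
  · simp only [coordCurvature, map_add, _root_.add_apply]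
    abel
  · rw [← eG, hΓ.metric_curvature_skew hy]
  · rw [← eJ, hΓ.curvature_parallel hJd (fun y hy ↦ hJ.endCoeff_parallel x₀ hy) hy]
  · have h := hc x₀ (coordVec x₀ x₀ x)
    rw [← metricCoeff_coordCurvature cov
      ((hΓ.contDiffAt_connection hy).differentiableAt (by simp)), ← endCoeff_vecCoord hx,
      vecCoord_coordVec hx] at h
    refine h.trans ?_
    rw [metricCoeff_apply, real_inner_self_eq_norm_sq]
    ring

end IsKaehlerStructure

end ComplexSpaceForm

/-! ### The immersed hypersurface in a pair of charts -/

section HypersurfaceInCharts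

open Topology

variable {E : Type*} [NormedAddCommGroup E] [NormedSpace ℝ E] [FiniteDimensional ℝ E]
  {M : Type*} [TopologicalSpace M] [ChartedSpace E M] [IsManifold 𝓘(ℝ, E) ∞ M]
  [RiemannianBundle (fun q : M ↦ TangentSpace 𝓘(ℝ, E) q)]
  {E' : Type*} [NormedAddCommGroup E'] [NormedSpace ℝ E'] [FiniteDimensional ℝ E']
  {P : Type*} [TopologicalSpace P] [ChartedSpace E' P] [IsManifold 𝓘(ℝ, E') ∞ P]
  [RiemannianBundle (fun x : P ↦ TangentSpace 𝓘(ℝ, E') x)]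
  {f : M → P} {N : Π q : M, TangentSpace 𝓘(ℝ, E') (f q)} {p q : M}

/-- The part of the chart at `p` which `f` maps to the domain of the chart at `f p`. -/
def chartDomain (f : M → P) (p : M) : Set E :=
  (chartAt E p).target ∩ (chartAt E p).symm ⁻¹' (f ⁻¹' (chartAt E' (f p)).source)

omit [NormedSpace ℝ E] [FiniteDimensional ℝ E] [IsManifold 𝓘(ℝ, E) ∞ M] [NormedSpace ℝ E']
  [FiniteDimensional ℝ E'] [IsManifold 𝓘(ℝ, E') ∞ P]
  [RiemannianBundle (fun q : M ↦ TangentSpace 𝓘(ℝ, E) q)]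
  [RiemannianBundle (fun x : P ↦ TangentSpace 𝓘(ℝ, E') x)] in
theorem chartAt_mem_chartDomain (f : M → P) (p : M) :
    chartAt E p p ∈ chartDomain (E := E) (E' := E') f p :=
  ⟨mem_chart_target E p, by
    rw [Set.mem_preimage, (chartAt E p).left_inv (mem_chart_source E p)]
    exact mem_chart_source E' (f p)⟩

omit [RiemannianBundle (fun q : M ↦ TangentSpace 𝓘(ℝ, E) q)]
  [RiemannianBundle (fun x : P ↦ TangentSpace 𝓘(ℝ, E') x)] [FiniteDimensional ℝ E] in
theorem covAlong_inCharts
    (cov : CovariantDerivative 𝓘(ℝ, E') E' (TangentSpace 𝓘(ℝ, E') : P → Type _))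
    {V : Π q : M, TangentSpace 𝓘(ℝ, E') (f q)}
    (hq : q ∈ (chartAt E p).source) (hfq : f q ∈ (chartAt E' (f p)).source)
    (hV : MDifferentiableAt 𝓘(ℝ, E) 𝓘(ℝ, E').tangent
      (fun q ↦ (⟨f q, V q⟩ : TangentBundle 𝓘(ℝ, E') P)) q) (u : TangentSpace 𝓘(ℝ, E) q) :
    covAlong (inChart (f p) (christoffel cov (f p))) (mapInCharts (E := E) (E' := E') f p)
      (alongInCharts f V p) (chartAt E p q) (vecCoord p q u)
      = vecCoord (f p) (f q) (covariantDerivativeAlong cov f V q u) := by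
  rw [vecCoord_covariantDerivativeAlong cov hq hfq hV, covAlong, mapInCharts, inChart_chartAt hq,
    inChart_chartAt hfq, alongInCharts, inChart_chartAt hq]

omit [FiniteDimensional ℝ E] [FiniteDimensional ℝ E']
  [RiemannianBundle (fun q : M ↦ TangentSpace 𝓘(ℝ, E) q)] in
theorem metric_mapInCharts (hq : q ∈ (chartAt E p).source)
    (hfq : f q ∈ (chartAt E' (f p)).source) (v w : TangentSpace 𝓘(ℝ, E') (f q)) :
    inChart (f p) (metricCoeff (E := E') (f p)) (mapInCharts (E := E) (E' := E') f p (chartAt E p q))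
      (vecCoord (f p) (f q) v) (vecCoord (f p) (f q) w) = inner ℝ v w := by
  rw [mapInCharts, inChart_chartAt hq, inChart_chartAt hfq, metricCoeff_vecCoord hfq]

namespace IsImmersedWithUnitNormal

variable (hf : IsImmersedWithUnitNormal (I := 𝓘(ℝ, E)) (I' := 𝓘(ℝ, E')) f N)
include hf

theorem contMDiff_map : ContMDiff 𝓘(ℝ, E) 𝓘(ℝ, E') ∞ f := fun q ↦
  ((contMDiffAt_along_iff (mem_chart_source E' (f q))).1 (hf.smooth q)).1

theorem mdifferentiableAt_map (q : M) : MDifferentiableAt 𝓘(ℝ, E) 𝓘(ℝ, E') f q :=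
  (hf.contMDiff_map q).mdifferentiableAt (by simp)

theorem mdifferentiableAt_normal (q : M) : MDifferentiableAt 𝓘(ℝ, E) 𝓘(ℝ, E').tangent
    (fun q ↦ (⟨f q, N q⟩ : TangentBundle 𝓘(ℝ, E') P)) q :=
  (hf.smooth q).mdifferentiableAt (by simp)

theorem normal_ne_zero (q : M) : N q ≠ 0 := by
  rw [← norm_ne_zero_iff, hf.unit]
  exact one_ne_zero

theorem exists_mfderiv_eq (hrank : Module.finrank ℝ E' = Module.finrank ℝ E + 1) (q : M)
    {w : TangentSpace 𝓘(ℝ, E') (f q)} (hw : inner ℝ (N q) w = 0) :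
    ∃ u, mfderiv 𝓘(ℝ, E) 𝓘(ℝ, E') f q u = w := by
  have : FiniteDimensional ℝ (TangentSpace 𝓘(ℝ, E) q) :=
    inferInstanceAs (FiniteDimensional ℝ E)
  have : FiniteDimensional ℝ (TangentSpace 𝓘(ℝ, E') (f q)) :=
    inferInstanceAs (FiniteDimensional ℝ E')
  exact exists_apply_eq_of_inner_normal_eq_zero (T := TangentSpace 𝓘(ℝ, E) q) hrank
    (D := (mfderiv 𝓘(ℝ, E) 𝓘(ℝ, E') f q : TangentSpace 𝓘(ℝ, E) q →ₗ[ℝ] _))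
    (hf.isometric q) (hf.normal_ne_zero q) (hf.normal q) hw

theorem isOpen_chartDomain (p : M) : IsOpen (chartDomain (E := E) (E' := E') f p) :=
  (chartAt E p).symm.continuousOn.isOpen_inter_preimage (chartAt E p).open_target
    ((chartAt E' (f p)).open_source.preimage hf.contMDiff_map.continuous)

theorem mapsTo_mapInCharts (p : M) : Set.MapsTo (mapInCharts (E := E) (E' := E') f p)
    (chartDomain (E := E) (E' := E') f p) (chartAt E' (f p)).target :=
  fun _ hy ↦ (chartAt E' (f p)).map_source hy.2

/-- Makes the coordinate Gauss and Codazzi equations available on a whole neighbourhood of `p`. For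
`spanning`, a vector orthogonal to `N` is tangent by the dimension count, and if it is also
orthogonal to all tangent vectors it is orthogonal to itself. -/
theorem isIsometricHypersurfaceOn (hrank : Module.finrank ℝ E' = Module.finrank ℝ E + 1) (p : M) :
    IsIsometricHypersurfaceOn (inChart p (metricCoeff (E := E) p))
      (inChart (f p) (metricCoeff (E := E') (f p))) (mapInCharts (E := E) (E' := E') f p) (alongInCharts f N p)
      (chartDomain (E := E) (E' := E') f p) := by
  have hdf {q : M} (hq : q ∈ (chartAt E p).source) (hfq : f q ∈ (chartAt E' (f p)).source)
      (u : E) : fderiv ℝ (mapInCharts (E := E) (E' := E') f p) (chartAt E p q) u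
        = vecCoord (f p) (f q) (mfderiv 𝓘(ℝ, E) 𝓘(ℝ, E') f q (coordVec p q u)) := by
    rw [vecCoord_mfderiv hq hfq (hf.mdifferentiableAt_map q), vecCoord_coordVec hq]
  have hN {q : M} (hq : q ∈ (chartAt E p).source) :
      alongInCharts f N p (chartAt E p q) = vecCoord (f p) (f q) (N q) := by
    rw [alongInCharts, inChart_chartAt hq]
  have hex {y : E} (hy : y ∈ chartDomain (E := E) (E' := E') f p) :
      ∃ q, q ∈ (chartAt E p).source ∧ f q ∈ (chartAt E' (f p)).source ∧ y = chartAt E p q :=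
    ⟨(chartAt E p).symm y, (chartAt E p).map_target hy.1, hy.2,
      ((chartAt E p).right_inv hy.1).symm⟩
  refine ⟨hf.isOpen_chartDomain p, fun y hy ↦ ?_, fun y hy ↦ ?_, fun y hy u v ↦ ?_,
    fun y hy u ↦ ?_, fun y hy ↦ ?_, fun y hy w hw hw' ↦ ?_⟩
  all_goals obtain ⟨q, hq, hfq, rfl⟩ := hex hy
  · have hφ : ContMDiffAt 𝓘(ℝ, E') 𝓘(ℝ, E') ∞ (chartAt E' (f p)) (f q) := by
      have := contMDiffAt_extChartAt' (I := 𝓘(ℝ, E')) (n := ∞) hfq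
      simpa using this
    have h := (contMDiffAt_iff_inChart (n := ⊤) hq _).1 (hφ.comp q (hf.contMDiff_map q))
    exact h.contDiffWithinAt
  · have h := ((contMDiffAt_along_iff hfq).1 (hf.smooth q)).2
    exact ((contMDiffAt_iff_inChart (n := ⊤) hq _).1 h).contDiffWithinAt
  · rw [hdf hq hfq, hdf hq hfq, metric_mapInCharts hq hfq, hf.isometric, inChart_chartAt hq,
      metricCoeff_apply]
  · rw [hdf hq hfq, hN hq, metric_mapInCharts hq hfq, hf.normal]
  · rw [hN hq, metric_mapInCharts hq hfq, real_inner_self_eq_norm_sq, hf.unit, one_pow]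
  · obtain ⟨w, rfl⟩ : ∃ w', w = vecCoord (f p) (f q) w' :=
      ⟨coordVec (f p) (f q) w, (vecCoord_coordVec hfq w).symm⟩
    rw [hN hq, metric_mapInCharts hq hfq, real_inner_comm] at hw'
    obtain ⟨u, rfl⟩ := hf.exists_mfderiv_eq hrank q hw'
    have h := hw (vecCoord p q u)
    rw [hdf hq hfq, metric_mapInCharts hq hfq, coordVec_vecCoord hq] at h
    rw [inner_self_eq_zero.1 h, map_zero]

variable (cov : CovariantDerivative 𝓘(ℝ, E') E' (TangentSpace 𝓘(ℝ, E') : P → Type _))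

theorem fderiv_mapInCharts (hq : q ∈ (chartAt E p).source)
    (hfq : f q ∈ (chartAt E' (f p)).source) (u : TangentSpace 𝓘(ℝ, E) q) :
    fderiv ℝ (mapInCharts (E := E) (E' := E') f p) (chartAt E p q) (vecCoord p q u)
      = vecCoord (f p) (f q) (mfderiv 𝓘(ℝ, E) 𝓘(ℝ, E') f q u) :=
  (vecCoord_mfderiv hq hfq (hf.mdifferentiableAt_map q) u).symm

/-- The tangential component is the adjoint of `df`, so pairing with `v` puts `df v` on the ambient
side. -/
theorem inner_shapeOperator (u v : TangentSpace 𝓘(ℝ, E) q) :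
    inner ℝ (shapeOperator cov f N q u) v
      = -inner ℝ (covariantDerivativeAlong cov f N q u) (mfderiv 𝓘(ℝ, E) 𝓘(ℝ, E') f q v) := by
  have : FiniteDimensional ℝ (TangentSpace 𝓘(ℝ, E) q) :=
    inferInstanceAs (FiniteDimensional ℝ E)
  have : FiniteDimensional ℝ (TangentSpace 𝓘(ℝ, E') (f q)) :=
    inferInstanceAs (FiniteDimensional ℝ E')
  rw [shapeOperator, inner_neg_left, tangentialComponent, LinearMap.adjoint_inner_left]
  rfl

/-- The second fundamental form in coordinates. -/
theorem secondForm_inCharts (hq : q ∈ (chartAt E p).source)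
    (hfq : f q ∈ (chartAt E' (f p)).source) (u v : TangentSpace 𝓘(ℝ, E) q) :
    secondForm (inChart (f p) (metricCoeff (E := E') (f p)))
      (inChart (f p) (christoffel cov (f p))) (mapInCharts (E := E) (E' := E') f p) (alongInCharts f N p)
      (vecCoord p q u) (vecCoord p q v) (chartAt E p q)
      = inner ℝ (shapeOperator cov f N q u) v := by
  rw [hf.inner_shapeOperator, secondForm,
    covAlong_inCharts cov hq hfq (hf.mdifferentiableAt_normal q), hf.fderiv_mapInCharts hq hfq,
    metric_mapInCharts hq hfq]

end IsImmersedWithUnitNormal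

end HypersurfaceInCharts

/-! ### Structure vector and Gauss equation in a complex space form -/

section ComplexSpaceFormHypersurface

open Topology

/-- At a point where `a`, `a'` and `b'` vanish, the product rule reduces the differentiated identity
to `b da = 0`. It is applied to a vanishing `2 × 2` minor of the second fundamental form. -/
theorem fderiv_eq_zero_of_mul_eventuallyEq {E : Type*} [NormedAddCommGroup E] [NormedSpace ℝ E]
    {a b a' b' : E → ℝ} {y : E} (h : ∀ᶠ z in 𝓝 y, a z * b z = a' z * b' z)
    (ha : DifferentiableAt ℝ a y) (hb : DifferentiableAt ℝ b y) (ha' : DifferentiableAt ℝ a' y)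
    (hb' : DifferentiableAt ℝ b' y) (h0 : a y = 0) (h0' : a' y = 0) (hb0' : b' y = 0)
    (hb0 : b y ≠ 0) : fderiv ℝ a y = 0 := by
  have e : (fun z ↦ a z * b z) =ᶠ[𝓝 y] fun z ↦ a' z * b' z := h
  have h1 := e.fderiv_eq (𝕜 := ℝ)
  rw [fderiv_fun_mul ha hb, fderiv_fun_mul ha' hb', h0, h0', hb0', zero_smul, zero_smul, zero_smul,
    zero_add, zero_add] at h1
  exact (smul_eq_zero.1 h1).resolve_left hb0

variable {E : Type*} [NormedAddCommGroup E] [NormedSpace ℝ E] [FiniteDimensional ℝ E]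
  {M : Type*} [TopologicalSpace M] [ChartedSpace E M] [IsManifold 𝓘(ℝ, E) ∞ M]
  [RiemannianBundle (fun q : M ↦ TangentSpace 𝓘(ℝ, E) q)]
  {E' : Type*} [NormedAddCommGroup E'] [NormedSpace ℝ E'] [FiniteDimensional ℝ E']
  {P : Type*} [TopologicalSpace P] [ChartedSpace E' P] [IsManifold 𝓘(ℝ, E') ∞ P]
  [RiemannianBundle (fun x : P ↦ TangentSpace 𝓘(ℝ, E') x)]
  {J : Π x : P, TangentSpace 𝓘(ℝ, E') x →L[ℝ] TangentSpace 𝓘(ℝ, E') x}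
  {covP : CovariantDerivative 𝓘(ℝ, E') E' (TangentSpace 𝓘(ℝ, E') : P → Type _)}
  {covM : CovariantDerivative 𝓘(ℝ, E) E (TangentSpace 𝓘(ℝ, E) : M → Type _)}
  {f : M → P} {N : Π q : M, TangentSpace 𝓘(ℝ, E') (f q)} {p q : M} {c : ℝ}

namespace IsKaehlerStructure

theorem inner_apply_left (hJ : IsKaehlerStructure covP J) {x : P}
    (u v : TangentSpace 𝓘(ℝ, E') x) : inner ℝ (J x u) v = -inner ℝ u (J x v) := by
  rw [← hJ.isometric x u (J x v), hJ.sq, inner_neg_right, neg_neg]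

theorem inner_apply_self (hJ : IsKaehlerStructure covP J) {x : P}
    (u : TangentSpace 𝓘(ℝ, E') x) : inner ℝ (J x u) u = 0 := by
  have h := hJ.inner_apply_left u u
  rw [real_inner_comm (J x u)] at h
  linarith

/-- The curvature tensor of a complex space form. -/
theorem inner_curvatureTensor
    [IsContMDiffRiemannianBundle 𝓘(ℝ, E') ∞ E' (fun x : P ↦ TangentSpace 𝓘(ℝ, E') x)]
    (hJ : IsKaehlerStructure covP J) (hcov : IsLeviCivita covP)
    (hc : HasConstantHolomorphicSectionalCurvature covP J c) {x : P}
    (u v w z : TangentSpace 𝓘(ℝ, E') x) :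
    inner ℝ (curvatureTensor covP x u v w) z
      = c / 4 * (inner ℝ v w * inner ℝ u z - inner ℝ u w * inner ℝ v z
        + inner ℝ (J x v) w * inner ℝ (J x u) z - inner ℝ (J x u) w * inner ℝ (J x v) z
        - 2 * inner ℝ (J x u) v * inner ℝ (J x w) z) := by
  have hx := mem_chart_source E' x
  have h := hJ.coordCurvature_eq hcov hc x (vecCoord x x u) (vecCoord x x v) (vecCoord x x w)
    (vecCoord x x z)
  rw [metricCoeff_coordCurvature covP (((hcov.isMetricConnectionOn x).contDiffAt_connection
    (mem_chart_target E' x)).differentiableAt (by simp))] at h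
  simpa only [endCoeff_vecCoord hx, metricCoeff_vecCoord hx] using h

end IsKaehlerStructure

namespace IsImmersedWithUnitNormal

variable (hf : IsImmersedWithUnitNormal (I := 𝓘(ℝ, E)) (I' := 𝓘(ℝ, E')) f N)
include hf

section Equations

variable [IsContMDiffRiemannianBundle 𝓘(ℝ, E) ∞ E (fun q : M ↦ TangentSpace 𝓘(ℝ, E) q)]
  [IsContMDiffRiemannianBundle 𝓘(ℝ, E') ∞ E' (fun x : P ↦ TangentSpace 𝓘(ℝ, E') x)]

theorem inner_shapeOperator_comm (hrank : Module.finrank ℝ E' = Module.finrank ℝ E + 1)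
    (hcovP : IsLeviCivita covP) (u v : TangentSpace 𝓘(ℝ, E) q) :
    inner ℝ (shapeOperator covP f N q u) v = inner ℝ (shapeOperator covP f N q v) u := by
  have hq := mem_chart_source E q
  have hfq := mem_chart_source E' (f q)
  rw [← hf.secondForm_inCharts covP hq hfq, ← hf.secondForm_inCharts covP hq hfq]
  exact (hf.isIsometricHypersurfaceOn hrank q).secondForm_symm (hcovP.isMetricConnectionOn (f q))
    (hf.mapsTo_mapInCharts q) (chartAt_mem_chartDomain f q) _ _

/-- The Gauss equation. -/
theorem inner_curvatureTensor_eq (hrank : Module.finrank ℝ E' = Module.finrank ℝ E + 1)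
    (hcovP : IsLeviCivita covP) (hcovM : IsLeviCivita covM) (u v w z : TangentSpace 𝓘(ℝ, E) q) :
    inner ℝ (curvatureTensor covM q u v w) z
      = inner ℝ (curvatureTensor covP (f q) (mfderiv 𝓘(ℝ, E) 𝓘(ℝ, E') f q u)
          (mfderiv 𝓘(ℝ, E) 𝓘(ℝ, E') f q v) (mfderiv 𝓘(ℝ, E) 𝓘(ℝ, E') f q w))
          (mfderiv 𝓘(ℝ, E) 𝓘(ℝ, E') f q z)
        + inner ℝ (shapeOperator covP f N q v) w * inner ℝ (shapeOperator covP f N q u) z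
        - inner ℝ (shapeOperator covP f N q u) w * inner ℝ (shapeOperator covP f N q v) z := by
  have hq := mem_chart_source E q
  have hfq := mem_chart_source E' (f q)
  have hM := hcovM.isMetricConnectionOn q
  have hP := hcovP.isMetricConnectionOn (f q)
  have h := (hf.isIsometricHypersurfaceOn hrank q).gauss hM hP (fun y hy ↦ hy.1)
    (hf.mapsTo_mapInCharts q) (chartAt_mem_chartDomain f q) (vecCoord q q u) (vecCoord q q v)
    (vecCoord q q w) (vecCoord q q z)
  simp only [hf.secondForm_inCharts covP hq hfq, hf.fderiv_mapInCharts hq hfq] at h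
  rw [inChart_chartAt hq, metricCoeff_coordCurvature covM
    ((hM.contDiffAt_connection (mem_chart_target E q)).differentiableAt (by simp))] at h
  rw [h, mapInCharts, inChart_chartAt hq, inChart_chartAt hfq, metricCoeff_coordCurvature covP
    ((hP.contDiffAt_connection (mem_chart_target E' (f q))).differentiableAt (by simp))]

end Equations

theorem shapeOperator_add (u v : TangentSpace 𝓘(ℝ, E) q) :
    shapeOperator covP f N q (u + v)
      = shapeOperator covP f N q u + shapeOperator covP f N q v := by
  refine ext_inner_right ℝ fun w ↦ ?_
  rw [inner_add_left, hf.inner_shapeOperator, hf.inner_shapeOperator, hf.inner_shapeOperator,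
    ← neg_add, ← inner_add_left]
  congr 2
  simp only [covariantDerivativeAlong, map_add]
  abel

theorem shapeOperator_smul (r : ℝ) (u : TangentSpace 𝓘(ℝ, E) q) :
    shapeOperator covP f N q (r • u) = r • shapeOperator covP f N q u := by
  refine ext_inner_right ℝ fun w ↦ ?_
  rw [real_inner_smul_left, hf.inner_shapeOperator, hf.inner_shapeOperator, mul_neg,
    ← real_inner_smul_left]
  congr 2
  simp only [covariantDerivativeAlong, map_smul, smul_add]

theorem inner_structureVectorField (u : TangentSpace 𝓘(ℝ, E) q) :
    inner ℝ (structureVectorField J f N q : TangentSpace 𝓘(ℝ, E) q) u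
      = -inner ℝ (J (f q) (N q)) (mfderiv 𝓘(ℝ, E) 𝓘(ℝ, E') f q u) := by
  have : FiniteDimensional ℝ (TangentSpace 𝓘(ℝ, E) q) :=
    inferInstanceAs (FiniteDimensional ℝ E)
  have : FiniteDimensional ℝ (TangentSpace 𝓘(ℝ, E') (f q)) :=
    inferInstanceAs (FiniteDimensional ℝ E')
  rw [structureVectorField, tangentialComponent, LinearMap.adjoint_inner_left, inner_neg_left]
  rfl

variable (hrank : Module.finrank ℝ E' = Module.finrank ℝ E + 1)
  (hJ : IsKaehlerStructure covP J)
include hrank hJ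

/-- `JN` is orthogonal to `N` and therefore already tangent, so taking the tangential component
loses nothing. -/
theorem mfderiv_structureVectorField (q : M) :
    mfderiv 𝓘(ℝ, E) 𝓘(ℝ, E') f q (structureVectorField J f N q) = -J (f q) (N q) := by
  obtain ⟨u, hu⟩ := hf.exists_mfderiv_eq hrank q (w := -J (f q) (N q))
    (by rw [inner_neg_right, real_inner_comm, hJ.inner_apply_self, neg_zero])
  have h : (structureVectorField J f N q : TangentSpace 𝓘(ℝ, E) q) = u :=
    ext_inner_right ℝ fun v ↦ by
      rw [hf.inner_structureVectorField, ← inner_neg_left, ← hu, hf.isometric]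
  rw [h, hu]

theorem inner_structureVectorField_self (q : M) :
    inner ℝ (structureVectorField J f N q : TangentSpace 𝓘(ℝ, E) q)
      (structureVectorField J f N q : TangentSpace 𝓘(ℝ, E) q) = 1 := by
  rw [← hf.isometric, hf.mfderiv_structureVectorField hrank hJ, inner_neg_neg, hJ.isometric,
    real_inner_self_eq_norm_sq, hf.unit, one_pow]

theorem inner_shapeOperator_structureVectorField (u : TangentSpace 𝓘(ℝ, E) q) :
    inner ℝ (shapeOperator covP f N q u) (structureVectorField J f N q : TangentSpace 𝓘(ℝ, E) q)
      = inner ℝ (covariantDerivativeAlong covP f N q u) (J (f q) (N q)) := by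
  rw [hf.inner_shapeOperator, hf.mfderiv_structureVectorField hrank hJ, inner_neg_right, neg_neg]

variable [IsContMDiffRiemannianBundle 𝓘(ℝ, E) ∞ E (fun q : M ↦ TangentSpace 𝓘(ℝ, E) q)]
  [IsContMDiffRiemannianBundle 𝓘(ℝ, E') ∞ E' (fun x : P ↦ TangentSpace 𝓘(ℝ, E') x)]

/-- The Gauss equation for a hypersurface of a complex space form with
`R(X, Y) ξ = κ (η(Y) X - η(X) Y)`. -/
theorem gauss_of_nullity (hcovP : IsLeviCivita covP) (hcovM : IsLeviCivita covM)
    (hc : HasConstantHolomorphicSectionalCurvature covP J c) {k : ℝ} {ξ : TangentSpace 𝓘(ℝ, E) q}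
    (hξ : structureVectorField J f N q = ξ)
    (hnull : ∀ X Y, curvatureTensor covM q X Y ξ = k • (inner ℝ Y ξ • X - inner ℝ X ξ • Y))
    (X Y Z : TangentSpace 𝓘(ℝ, E) q) :
    (k - c / 4) * (inner ℝ Y ξ * inner ℝ X Z - inner ℝ X ξ * inner ℝ Y Z)
      = inner ℝ (shapeOperator covP f N q Y) ξ * inner ℝ (shapeOperator covP f N q X) Z
        - inner ℝ (shapeOperator covP f N q X) ξ * inner ℝ (shapeOperator covP f N q Y) Z := by
  have h := hf.inner_curvatureTensor_eq hrank hcovP hcovM X Y ξ Z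
  -- This and `Jξ = N` annihilate every `J`-term of the ambient curvature; the remaining constant
  -- curvature part combines with `k` into `k - c/4`.
  have hJN (u : TangentSpace 𝓘(ℝ, E) q) :
      inner ℝ (J (f q) (mfderiv 𝓘(ℝ, E) 𝓘(ℝ, E') f q u)) (mfderiv 𝓘(ℝ, E) 𝓘(ℝ, E') f q ξ) = 0 := by
    rw [← hξ, hf.mfderiv_structureVectorField hrank hJ, inner_neg_right, hJ.isometric,
      real_inner_comm, hf.normal, neg_zero]
  have hJξ : J (f q) (mfderiv 𝓘(ℝ, E) 𝓘(ℝ, E') f q ξ) = N q := by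
    rw [← hξ, hf.mfderiv_structureVectorField hrank hJ, map_neg, hJ.sq, neg_neg]
  rw [hnull, hJ.inner_curvatureTensor hcovP hc, hJN, hJN, hJξ, hf.normal, hf.isometric,
    hf.isometric, hf.isometric, hf.isometric, real_inner_smul_left, inner_sub_left,
    real_inner_smul_left, real_inner_smul_left] at h
  linear_combination h

end IsImmersedWithUnitNormal

end ComplexSpaceFormHypersurface

/-! ### The contradiction from the Codazzi equation -/

section Hopf

open Topology

variable {E : Type*} [NormedAddCommGroup E] [NormedSpace ℝ E] [FiniteDimensional ℝ E]
  {M : Type*} [TopologicalSpace M] [ChartedSpace E M] [IsManifold 𝓘(ℝ, E) ∞ M]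
  [RiemannianBundle (fun q : M ↦ TangentSpace 𝓘(ℝ, E) q)]
  {E' : Type*} [NormedAddCommGroup E'] [NormedSpace ℝ E'] [FiniteDimensional ℝ E']
  {P : Type*} [TopologicalSpace P] [ChartedSpace E' P] [IsManifold 𝓘(ℝ, E') ∞ P]
  [RiemannianBundle (fun x : P ↦ TangentSpace 𝓘(ℝ, E') x)]
  {J : Π x : P, TangentSpace 𝓘(ℝ, E') x →L[ℝ] TangentSpace 𝓘(ℝ, E') x}
  {covP : CovariantDerivative 𝓘(ℝ, E') E' (TangentSpace 𝓘(ℝ, E') : P → Type _)}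
  {covM : CovariantDerivative 𝓘(ℝ, E) E (TangentSpace 𝓘(ℝ, E) : M → Type _)}
  {f : M → P} {N : Π q : M, TangentSpace 𝓘(ℝ, E') (f q)} {p q : M} {c : ℝ}

namespace IsImmersedWithUnitNormal

variable (hf : IsImmersedWithUnitNormal (I := 𝓘(ℝ, E)) (I' := 𝓘(ℝ, E')) f N)
  (hrank : Module.finrank ℝ E' = Module.finrank ℝ E + 1)
  (hJ : IsKaehlerStructure covP J)
  [IsContMDiffRiemannianBundle 𝓘(ℝ, E) ∞ E (fun q : M ↦ TangentSpace 𝓘(ℝ, E) q)]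
  [IsContMDiffRiemannianBundle 𝓘(ℝ, E') ∞ E' (fun x : P ↦ TangentSpace 𝓘(ℝ, E') x)]
  (hcovP : IsLeviCivita covP)
include hf hrank hJ hcovP

/-- The structure vector is not principal on an open set. -/
theorem eventually_not_principal {a b : TangentSpace 𝓘(ℝ, E) p}
    {ξ : Π q : M, TangentSpace 𝓘(ℝ, E) q} (hξ : ∀ q, structureVectorField J f N q = ξ q)
    (h : inner ℝ (shapeOperator covP f N p a) (ξ p) * inner ℝ (ξ p) b
      - inner ℝ (shapeOperator covP f N p b) (ξ p) * inner ℝ (ξ p) a ≠ 0) :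
    ∀ᶠ y in 𝓝 (chartAt E p p), ∀ r : ℝ,
      (shapeOperator covP f N ((chartAt E p).symm y) (ξ ((chartAt E p).symm y)) :
        TangentSpace 𝓘(ℝ, E) ((chartAt E p).symm y)) ≠ r • ξ ((chartAt E p).symm y) := by
  have hdom := chartAt_mem_chartDomain (E := E) (E' := E') f p
  have hO := hf.mapsTo_mapInCharts p
  have hS := hf.isIsometricHypersurfaceOn hrank p
  have hG := hcovP.isMetricConnectionOn (f p)
  set G : E' → E' →L[ℝ] E' →L[ℝ] ℝ := inChart (f p) (metricCoeff (f p)) with hGdef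
  set F : E → E' := mapInCharts f p with hFdef
  set Nc : E → E' := alongInCharts f N p with hNdef
  set Γ : E' → E' →L[ℝ] E' →L[ℝ] E' := inChart (f p) (christoffel covP (f p)) with hΓdef
  set Jc : E' → E' →L[ℝ] E' := inChart (f p) (endCoeff J (f p)) with hJdef
  let θ : E → E → ℝ := fun u y ↦ G (F y) (covAlong Γ F Nc y u) (Jc (F y) (Nc y))
  let η : E → E → ℝ := fun u y ↦ G (F y) (Jc (F y) (Nc y)) (fderiv ℝ F y u)
  have hJN : ContDiffAt ℝ ∞ (fun y ↦ Jc (F y) (Nc y)) (chartAt E p p) :=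
    (((hJ.contDiffOn_endCoeff (f p)).contDiffAt (hG.isOpen.mem_nhds (hO hdom))).comp _
      (hS.contDiffAt_map hdom)).clm_apply (hS.contDiffAt_normal hdom)
  have hθ (u : E) : ContinuousAt (θ u) (chartAt E p p) :=
    (hG.contDiffAt_metric_along (hO hdom) (hS.contDiffAt_map hdom)
      ((hG.contDiffAt_connection (hO hdom)).covAlong (hS.contDiffAt_map hdom)
        (hS.contDiffAt_normal hdom) u) hJN).continuousAt
  have hη (u : E) : ContinuousAt (η u) (chartAt E p p) :=
    (hG.contDiffAt_metric_along (hO hdom) (hS.contDiffAt_map hdom) hJN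
      ((hS.contDiffAt_map hdom).fderiv_apply_const u)).continuousAt
  have hJNq {q : M} (hq : q ∈ (chartAt E p).source) (hfq : f q ∈ (chartAt E' (f p)).source) :
      Jc (F (chartAt E p q)) (Nc (chartAt E p q)) = vecCoord (f p) (f q) (J (f q) (N q)) := by
    rw [hJdef, hFdef, hNdef, mapInCharts, inChart_chartAt hq, inChart_chartAt hfq,
      alongInCharts, inChart_chartAt hq, endCoeff_vecCoord hfq]
  have hθq {q : M} (hq : q ∈ (chartAt E p).source) (hfq : f q ∈ (chartAt E' (f p)).source)
      (u : TangentSpace 𝓘(ℝ, E) q) :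
      θ (vecCoord p q u) (chartAt E p q) = inner ℝ (shapeOperator covP f N q u) (ξ q) := by
    rw [← hξ, hf.inner_shapeOperator_structureVectorField hrank hJ]
    simp only [θ]
    rw [hJNq hq hfq, covAlong_inCharts covP hq hfq (hf.mdifferentiableAt_normal q),
      metric_mapInCharts hq hfq]
  have hηq {q : M} (hq : q ∈ (chartAt E p).source) (hfq : f q ∈ (chartAt E' (f p)).source)
      (u : TangentSpace 𝓘(ℝ, E) q) :
      η (vecCoord p q u) (chartAt E p q) = -inner ℝ (ξ q) u := by
    rw [← hξ, hf.inner_structureVectorField, neg_neg]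
    simp only [η]
    rw [hJNq hq hfq, hf.fderiv_mapInCharts hq hfq, metric_mapInCharts hq hfq]
  -- The two-form `θ ∧ η` is continuous and nonzero at `p` on the pair `a, b`. If `Aξ = rξ`,
  -- self-adjointness makes `θ` a multiple of `η` and the form vanishes.
  have hne : ∀ᶠ y in 𝓝 (chartAt E p p), θ (vecCoord p p a) y * η (vecCoord p p b) y
      - θ (vecCoord p p b) y * η (vecCoord p p a) y ≠ 0 := by
    refine (((hθ _).mul (hη _)).sub ((hθ _).mul (hη _))).eventually_ne ?_
    have hp := mem_chart_source E p
    have hfp := mem_chart_source E' (f p)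
    rw [Pi.sub_apply, Pi.mul_apply, Pi.mul_apply, hθq hp hfp, hθq hp hfp, hηq hp hfp, hηq hp hfp]
    exact fun h' ↦ h (by linear_combination -h')
  filter_upwards [hne, (hf.isOpen_chartDomain p).mem_nhds hdom] with y hy hyO r hr
  have hq := (chartAt E p).map_target hyO.1
  have hfq : f ((chartAt E p).symm y) ∈ (chartAt E' (f p)).source := hyO.2
  set q := (chartAt E p).symm y with hqdef
  have hyq : y = chartAt E p q := ((chartAt E p).right_inv hyO.1).symm
  have e (u : E) : θ u y = -(r * η u y) := by
    have h1 := hθq hq hfq (coordVec p q u)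
    have h2 := hηq hq hfq (coordVec p q u)
    rw [vecCoord_coordVec hq, ← hyq] at h1 h2
    rw [h1, h2, hf.inner_shapeOperator_comm hrank hcovP, hr, real_inner_smul_left]
    ring
  exact hy (by rw [e, e]; ring)

/-- The consequences of the nullity condition at a point where the structure vector `ξ` is not
principal. -/
theorem rank_one_of_not_principal (hcovM : IsLeviCivita covM)
    (hc : HasConstantHolomorphicSectionalCurvature covP J c) {k : ℝ}
    {ξ : TangentSpace 𝓘(ℝ, E) q} (hξ : structureVectorField J f N q = ξ)
    (hnull : ∀ X Y, curvatureTensor covM q X Y ξ = k • (inner ℝ Y ξ • X - inner ℝ X ξ • Y))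
    (hp : ∀ r : ℝ, shapeOperator covP f N q ξ ≠ r • ξ) :
    ∃ (α : ℝ) (v V : TangentSpace 𝓘(ℝ, E) q), α ≠ 0 ∧ v ≠ 0 ∧
      shapeOperator covP f N q ξ = v + α • ξ ∧ inner ℝ v ξ = 0 ∧
      mfderiv 𝓘(ℝ, E) 𝓘(ℝ, E') f q V = J (f q) (mfderiv 𝓘(ℝ, E) 𝓘(ℝ, E') f q v) ∧
      shapeOperator covP f N q V = 0 ∧
      shapeOperator covP f N q (inner ℝ v v • ξ - α • v) = 0 ∧
      inner ℝ (shapeOperator covP f N q v) v ≠ 0 ∧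
      ∀ X Y Z W : TangentSpace 𝓘(ℝ, E) q,
        inner ℝ (shapeOperator covP f N q X) Z * inner ℝ (shapeOperator covP f N q Y) W
        = inner ℝ (shapeOperator covP f N q X) W * inner ℝ (shapeOperator covP f N q Y) Z := by
  let A : TangentSpace 𝓘(ℝ, E) q →ₗ[ℝ] TangentSpace 𝓘(ℝ, E) q :=
    { toFun := shapeOperator covP f N q
      map_add' := hf.shapeOperator_add
      map_smul' := hf.shapeOperator_smul }
  have hξ1 : inner ℝ ξ ξ = (1 : ℝ) := by
    rw [← hξ]
    exact hf.inner_structureVectorField_self hrank hJ q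
  set α : ℝ := inner ℝ (A ξ) ξ with hα
  set v : TangentSpace 𝓘(ℝ, E) q := A ξ - α • ξ with hv
  have hv0 : v ≠ 0 := fun h ↦ hp α (sub_eq_zero.1 h)
  have hvξ : inner ℝ v ξ = 0 := by
    rw [hv, inner_sub_left, real_inner_smul_left, hξ1, hα]
    ring
  -- `Jv` is tangent: `⟨Jv, N⟩ = -⟨v, JN⟩ = ⟨v, ξ⟩ = 0`.
  obtain ⟨V, hV⟩ := hf.exists_mfderiv_eq hrank q
    (w := J (f q) (mfderiv 𝓘(ℝ, E) 𝓘(ℝ, E') f q v)) (by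
      have h := hf.inner_structureVectorField (J := J) v
      rw [hξ, real_inner_comm, hvξ] at h
      rw [real_inner_comm, hJ.inner_apply_left, real_inner_comm]
      exact h.symm)
  have hVξ : inner ℝ V ξ = 0 := by
    rw [← hf.isometric, hV, ← hξ, hf.mfderiv_structureVectorField hrank hJ, inner_neg_right,
      hJ.isometric, real_inner_comm, hf.normal, neg_zero]
  have hVv : inner ℝ V v = 0 := by
    rw [← hf.isometric, hV, hJ.inner_apply_self]
  have hV0 : V ≠ 0 := by
    rw [← inner_self_ne_zero (𝕜 := ℝ), ← hf.isometric, hV, hJ.isometric, hf.isometric]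
    exact inner_self_ne_zero.2 hv0
  obtain ⟨h1, -, h3, h4, h5, h6⟩ := rank_one_of_nullity (A := A) (ξ := ξ) (v := v) (V := V)
    (fun x y ↦ (hf.inner_shapeOperator_comm hrank hcovP x y).trans (real_inner_comm _ _)) hξ1 rfl
    hv0 hV0 hVξ hVv (hf.gauss_of_nullity hrank hJ hcovP hcovM hc hξ hnull)
  exact ⟨α, v, V, h3, hv0, (sub_add_cancel _ _).symm, hvξ, hV, h1, h5, h4, h6⟩

/-- The Codazzi equation in directions in the kernel of the shape operator, for a hypersurface of a
complex space form. -/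
theorem codazzi_of_shapeOperator_eq_zero
    (hc : HasConstantHolomorphicSectionalCurvature covP J c) {X Y : TangentSpace 𝓘(ℝ, E) p}
    (hX : shapeOperator covP f N p X = 0) (hY : shapeOperator covP f N p Y = 0)
    {h : E → E → E → ℝ}
    (hh : h = secondForm (inChart (f p) (metricCoeff (E := E') (f p)))
      (inChart (f p) (christoffel covP (f p))) (mapInCharts (E := E) (E' := E') f p)
      (alongInCharts f N p)) :
    -3 * (c / 4) * (inner ℝ (J (f p) (mfderiv 𝓘(ℝ, E) 𝓘(ℝ, E') f p X))
        (mfderiv 𝓘(ℝ, E) 𝓘(ℝ, E') f p Y)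
        * inner ℝ (J (f p) (N p)) (mfderiv 𝓘(ℝ, E) 𝓘(ℝ, E') f p Y))
      = fderiv ℝ (h (vecCoord p p X) (vecCoord p p Y)) (chartAt E p p) (vecCoord p p Y)
        - fderiv ℝ (h (vecCoord p p Y) (vecCoord p p Y)) (chartAt E p p) (vecCoord p p X) := by
  have hp := mem_chart_source E p
  have hfp := mem_chart_source E' (f p)
  have hG := hcovP.isMetricConnectionOn (f p)
  have hker {u : TangentSpace 𝓘(ℝ, E) p} (hu : shapeOperator covP f N p u = 0) (w : E) :
      h (vecCoord p p u) w (chartAt E p p) = 0 := by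
    have h1 := hf.secondForm_inCharts covP hp hfp u (coordVec p p w)
    rw [vecCoord_coordVec hp, hu, inner_zero_left] at h1
    rw [hh, h1]
  subst hh
  have h1 := (hf.isIsometricHypersurfaceOn hrank p).codazzi_of_eq_zero hG
    (hf.mapsTo_mapInCharts p) (chartAt_mem_chartDomain f p) (hker hX) (hker hY) (vecCoord p p Y)
  -- In `⟨R(X, Y)N, Y⟩` the terms with `⟨X, N⟩`, `⟨Y, N⟩` or `⟨JY, Y⟩` vanish. Of the coefficient
  -- `-3`, one unit comes from `⟨JY, N⟩⟨JX, Y⟩` and two from the last term of the curvature formula.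
  rw [← h1, hf.fderiv_mapInCharts hp hfp, hf.fderiv_mapInCharts hp hfp, alongInCharts,
    inChart_chartAt hp, mapInCharts, inChart_chartAt hp, inChart_chartAt hfp,
    metricCoeff_coordCurvature covP
      ((hG.contDiffAt_connection (mem_chart_target E' (f p))).differentiableAt (by simp)),
    hJ.inner_curvatureTensor hcovP hc, hJ.inner_apply_self, real_inner_comm (N p),
    real_inner_comm (N p), hf.normal, hf.normal, hJ.inner_apply_left _ (N p),
    real_inner_comm (J (f p) (N p))]
  ring

theorem exists_principal (hcovM : IsLeviCivita covM) (hc0 : c ≠ 0)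
    (hc : HasConstantHolomorphicSectionalCurvature covP J c) {k : M → ℝ}
    {ξ : Π q : M, TangentSpace 𝓘(ℝ, E) q} (hξ : ∀ q, structureVectorField J f N q = ξ q)
    (hnull : ∀ q X Y, curvatureTensor covM q X Y (ξ q)
      = k q • (inner ℝ Y (ξ q) • X - inner ℝ X (ξ q) • Y)) (p : M) :
    ∃ r : ℝ, shapeOperator covP f N p (ξ p) = r • ξ p := by
  by_contra! hcon
  have hrk (q : M) (hq : ∀ r : ℝ, shapeOperator covP f N q (ξ q) ≠ r • ξ q) :=
    hf.rank_one_of_not_principal hrank hJ hcovP hcovM hc (hξ q) (hnull q) hq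
  have hp := mem_chart_source E p
  have hfp := mem_chart_source E' (f p)
  have hξ1 : inner ℝ (ξ p) (ξ p) = (1 : ℝ) := by
    rw [← hξ]
    exact hf.inner_structureVectorField_self hrank hJ p
  obtain ⟨α, v, V, hα, hv0, hAξ, hvξ, hV, hAV, hAW, hAv, -⟩ := hrk p hcon
  have hvv : inner ℝ v v ≠ (0 : ℝ) := inner_self_ne_zero.2 hv0
  set W : TangentSpace 𝓘(ℝ, E) p := inner ℝ v v • ξ p - α • v with hW
  -- For `a = v` and `b = ξ` the value of the two-form is `|v|²`.
  have hnear := hf.eventually_not_principal hrank hJ hcovP (a := v) (b := ξ p) hξ (by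
    rw [hf.inner_shapeOperator_comm hrank hcovP, hAξ, hξ1, real_inner_comm v (ξ p), hvξ,
      inner_add_left, real_inner_smul_left, real_inner_comm v (ξ p), hvξ]
    simpa using hvv)
  set h := secondForm (inChart (f p) (metricCoeff (E := E') (f p)))
      (inChart (f p) (christoffel covP (f p))) (mapInCharts (E := E) (E' := E') f p)
      (alongInCharts f N p) with hh
  have hdom := chartAt_mem_chartDomain (E := E) (E' := E') f p
  -- Rank one is needed on a neighbourhood, with fixed coordinate vectors, because these minors are
  -- differentiated at `p`.
  have hrel (a b a' b' : E) : ∀ᶠ y in 𝓝 (chartAt E p p),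
      h a b y * h a' b' y = h a b' y * h a' b y := by
    filter_upwards [hnear, (hf.isOpen_chartDomain p).mem_nhds hdom] with y hy hyO
    have hq := (chartAt E p).map_target hyO.1
    have hfq : f ((chartAt E p).symm y) ∈ (chartAt E' (f p)).source := hyO.2
    have hyq : y = chartAt E p ((chartAt E p).symm y) := ((chartAt E p).right_inv hyO.1).symm
    obtain ⟨-, -, -, -, -, -, -, -, -, -, -, hmin⟩ := hrk _ hy
    have e (u w : E) : h u w y = inner ℝ (shapeOperator covP f N ((chartAt E p).symm y)
        (coordVec p _ u)) (coordVec p ((chartAt E p).symm y) w) := by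
      have := hf.secondForm_inCharts covP hq hfq (coordVec p _ u) (coordVec p _ w)
      rw [vecCoord_coordVec hq, vecCoord_coordVec hq, ← hyq] at this
      exact this
    rw [e, e, e, e, hmin]
  have hd (a b : E) : DifferentiableAt ℝ (h a b) (chartAt E p p) :=
    ((hf.isIsometricHypersurfaceOn hrank p).contDiffAt_secondForm
      (hcovP.isMetricConnectionOn (f p)) (hf.mapsTo_mapInCharts p) hdom a b).differentiableAt
      (by simp)
  have hval (a b : TangentSpace 𝓘(ℝ, E) p) :
      h (vecCoord p p a) (vecCoord p p b) (chartAt E p p)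
        = inner ℝ (shapeOperator covP f N p a) b := hf.secondForm_inCharts covP hp hfp a b
  have hvW : inner ℝ (shapeOperator covP f N p v) W = 0 := by
    rw [hf.inner_shapeOperator_comm hrank hcovP, hAW, inner_zero_left]
  -- Differentiate `h(a, W) h(v, v) = h(a, v) h(v, W)`: at `p` every factor except `h(v, v)` is
  -- zero.
  have hder (a : TangentSpace 𝓘(ℝ, E) p) (ha : shapeOperator covP f N p a = 0) :
      fderiv ℝ (h (vecCoord p p a) (vecCoord p p W)) (chartAt E p p) = 0 := by
    refine fderiv_eq_zero_of_mul_eventuallyEq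
      (hrel (vecCoord p p a) (vecCoord p p W) (vecCoord p p v) (vecCoord p p v)) (hd _ _) (hd _ _)
      (hd _ _) (hd _ _) ?_ ?_ ?_ ?_
    · rw [hval, ha, inner_zero_left]
    · rw [hval, ha, inner_zero_left]
    · rw [hval, hvW]
    · rw [hval]
      exact hAv
  have hcod := hf.codazzi_of_shapeOperator_eq_zero hrank hJ hcovP hc hAV hAW hh
  rw [hder V hAV, hder W hAW, _root_.zero_apply, _root_.zero_apply, sub_zero, hV, hJ.sq,
    inner_neg_left, hf.isometric] at hcod
  have h1 : inner ℝ (ξ p) W = inner ℝ v v := by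
    rw [hW, inner_sub_right, real_inner_smul_right, real_inner_smul_right, hξ1,
      real_inner_comm v (ξ p), hvξ]
    ring
  have h2 : inner ℝ v W = -(α * inner ℝ v v) := by
    rw [hW, inner_sub_right, real_inner_smul_right, real_inner_smul_right, hvξ]
    ring
  rw [← hξ, hf.inner_structureVectorField] at h1
  rw [h2, ← neg_neg (inner ℝ (J (f p) (N p)) _), h1] at hcod
  -- Here `⟨JV, W⟩ = -⟨v, W⟩ = α|v|²` and `⟨JN, W⟩ = -⟨ξ, W⟩ = -|v|²`, so the Codazzi equation reads
  -- `(3/4) c α |v|⁴ = 0`.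
  have h3 : c * α * (inner ℝ v v * inner ℝ v v) = 0 := by linear_combination (4 / 3) * hcod
  exact mul_ne_zero (mul_ne_zero hc0 hα) (mul_ne_zero hvv hvv) h3

end IsImmersedWithUnitNormal

end Hopf

end

theorem mainTheorem4
    -- the ambient space: a complex space form of complex dimension 2 with `c ≠ 0`
    {P : Type*} [TopologicalSpace P] [ChartedSpace (EuclideanSpace ℝ (Fin 4)) P]
    [IsManifold (𝓡 4) ∞ P]
    [RiemannianBundle (fun x : P ↦ TangentSpace (𝓡 4) x)]
    [IsContMDiffRiemannianBundle (𝓡 4) ∞ (EuclideanSpace ℝ (Fin 4))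
      (fun x : P ↦ TangentSpace (𝓡 4) x)]
    (covP : CovariantDerivative (𝓡 4) (EuclideanSpace ℝ (Fin 4))
      (TangentSpace (𝓡 4) : P → Type _))
    (hcovP : IsLeviCivita covP)
    (J : Π x : P, TangentSpace (𝓡 4) x →L[ℝ] TangentSpace (𝓡 4) x)
    (hJ : IsKaehlerStructure covP J)
    (c : ℝ) (hc : c ≠ 0)
    (hcurv : HasConstantHolomorphicSectionalCurvature covP J c)
    -- the real hypersurface, with the induced metric and a unit normal vector field
    {M : Type*} [TopologicalSpace M] [ChartedSpace (EuclideanSpace ℝ (Fin 3)) M]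
    [IsManifold (𝓡 3) ∞ M]
    [RiemannianBundle (fun q : M ↦ TangentSpace (𝓡 3) q)]
    [IsContMDiffRiemannianBundle (𝓡 3) ∞ (EuclideanSpace ℝ (Fin 3))
      (fun q : M ↦ TangentSpace (𝓡 3) q)]
    (covM : CovariantDerivative (𝓡 3) (EuclideanSpace ℝ (Fin 3))
      (TangentSpace (𝓡 3) : M → Type _))
    (hcovM : IsLeviCivita covM)
    (f : M → P) (N : Π q : M, TangentSpace (𝓡 4) (f q))
    (hf : IsImmersedWithUnitNormal (I := 𝓡 3) (I' := 𝓡 4) f N)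
    -- `R(X, Y) ξ = κ [η(Y) X - η(X) Y]` with `η(X) = g(X, ξ)`
    (κ : M → ℝ) (hκ : ContMDiff (𝓡 3) 𝓘(ℝ, ℝ) ∞ κ)
    (hnull : ∀ (p : M) (X Y : TangentSpace (𝓡 3) p),
      curvatureTensor covM p X Y (structureVectorField J f N p)
        = κ p • (inner ℝ Y (structureVectorField J f N p : TangentSpace (𝓡 3) p) • X
          - inner ℝ X (structureVectorField J f N p : TangentSpace (𝓡 3) p) • Y)) :
    IsHopf (I := 𝓡 3) covP J f N := by
  have hrank : Module.finrank ℝ (EuclideanSpace ℝ (Fin 4))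
      = Module.finrank ℝ (EuclideanSpace ℝ (Fin 3)) + 1 := by simp
  refine fun p ↦ ⟨?_, hf.exists_principal hrank hJ hcovP hcovM hc hcurv (fun _ ↦ rfl) hnull p⟩
  rw [← inner_self_ne_zero (𝕜 := ℝ), hf.inner_structureVectorField_self hrank hJ]
  exact one_ne_zero
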